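/- Let $q$ be a prime power, $\mathbb F$ the field with $q$ elements, and $F$ a field of prime characteristic $p\nmid q$. Put $[i]_q=1+q+\dots+q^{i-1}$ and $m=m(p,q)=\min\{i>1: p\mid [i]_q\}$. For $n\ge 0$ and $k\in\mathbb Z$ let $M^n_k$ be the $F$-vector space with basis the $k$-dimensional subspaces of $\mathbb F^n$ (so $M^n_k=0$ unless $0\le k\le n$), and let $\partial:M^n_k\to M^n_{k-1}$ be the linear map sending a subspace $x$ to the sum of all subspaces of codimension one in $x$; then $\partial^m=0$. For $k\in\mathbb Z$ and $0<i<m$ let $\mathcal M^n_{k,i}$ be the sequence $$\cdots\leftarrow M^n_{k-m}\leftarrow M^n_{k-i}\xleftarrow{\ \partial^i\ }M^n_k\xleftarrow{\ \partial^{m-i}\ }M^n_{k+m-i}\xleftarrow{\ \partial^{i}\ }M^n_{k+m}\leftarrow\cdots,$$ whose maps are alternately $\partial^i$ and $\partial^{m-i}$, and put $$H^n_{k,i}=(\ker\partial^i\cap M^n_k)/\partial^{m-i}(M^n_{k+m-i}),\qquad \beta^n_{k,i}=\dim_F H^n_{k,i}.$$ Write $(k,i)\sim(k',i')$ if these pairs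 define the same sequence, i.e. $(k',i')=(k+tm,i)$ or $(k',i')=(k-i+tm,m-i)$ for some $t\in\mathbb Z$. Call $(k,i)$ a middle index for $n$ if $0\le k\le n$, $0<i<m$ and $n<2k+m-i<n+m$. (a) Suppose $m=2$. If $n$ is odd, then $\mathcal M^n_{k,1}$ is exact for every $k$. If $n=2k$ is even, then $$\beta^n_{k,1}=(q^{n-1}-1)(q^{n-3}-1)\cdots(q-1)$$ (the empty product $1$ for $n=0$). (b) Suppose $m=3$. For each $n\ge 0$ there are exactly two middle indices, one of the form $(k,1)$ and one of the form $(k',2)$. For $l\in\mathbb Z$ and $i\in\{1,2\}$, the homology $H^n_{l,i}$ is nonzero if and only if $(l,i)$ is one of these two, and the sequence $\mathcal M^n_{l,i}$ fails to be exact if and only if $(l,i)\sim(k,1)$ or $(l,i)\sim(k',2)$. Moreover $\beta^n_{k,1}=\beta^n_{k',2}=:\beta^n$ depends only on $n$ (and $q$), and $$\beta^n=\beta^{n-1}+(q^{n-1}-1)\,\beta^{n-2}\quad(n\ge 2),\qquad \beta^0=\beta^1=1.$$ -/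

import Mathlib

open Module

/-- The quantum characteristic `m(p, q) = min {i > 1 : [i]_q = 0 in GF(p)}`, where
`[i]_q = 1 + q + ⋯ + q^(i-1)`. -/
noncomputable def quantumChar (p q : ℕ) : ℕ :=
  sInf {i : ℕ | 1 < i ∧ ((∑ j ∈ Finset.range i, q ^ j : ℕ) : ZMod p) = 0}

namespace ProjIncidence

variable (K F : Type*) [Field K] [Finite K] [Field F] (n : ℕ)

/-- The projective space `P(n, q)`: all subspaces of `K ^ n`, ordered by inclusion. -/
abbrev ProjSpace (K : Type*) [Field K] (n : ℕ) : Type _ := Submodule K (Fin n → K)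

/-- The `F`-vector space with basis all subspaces of `K ^ n` (finitely many): the subspace `x` is
identified with the indicator function `Pi.single x 1`. -/
abbrev ChainSpace : Type _ := ProjSpace K n → F

open Classical in
/-- The incidence map `∂`: it sends the basis element of a subspace `x` to the sum of all subspaces
`y` of codimension one in `x`. -/
noncomputable def bd : ChainSpace K F n →ₗ[F] ChainSpace K F n :=
  (Pi.basisFun F (ProjSpace K n)).constr F fun x : ProjSpace K n =>
    ∑ y ∈ (Set.toFinite {y : ProjSpace K n | y ≤ x ∧ finrank K y + 1 = finrank K x}).toFinset,
      Pi.single y (1 : F)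

/-- `M_k`, for `k ∈ ℤ`: the span of the `k`-dimensional subspaces, i.e. the functions supported on
them (zero for `k < 0` or `k > n`). -/
def chains (k : ℤ) : Submodule F (ChainSpace K F n) where
  carrier := {f | ∀ x : ProjSpace K n, (finrank K x : ℤ) ≠ k → f x = 0}
  add_mem' hf hg x hx := by simp [hf x hx, hg x hx]
  zero_mem' _ _ := rfl
  smul_mem' c f hf x hx := by simp [hf x hx]

/-- `K_{k,i} = ker ∂^i ∩ M_k`. -/
noncomputable def cycles (k : ℤ) (i : ℕ) : Submodule F (ChainSpace K F n) :=
  LinearMap.ker (bd K F n ^ i) ⊓ chains K F n k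

/-- `I_{k,i} = ∂^(m-i) (M_{k+m-i})`, for `i ≤ m`. -/
noncomputable def boundaries (m : ℕ) (k : ℤ) (i : ℕ) : Submodule F (ChainSpace K F n) :=
  (chains K F n (k + m - i)).map (bd K F n ^ (m - i))

/-- The incidence homology `H_{k,i} = K_{k,i} / I_{k,i}`, for `0 < i < m`. -/
abbrev Homology (m : ℕ) (k : ℤ) (i : ℕ) : Type _ :=
  cycles K F n k i ⧸ (boundaries K F n m k i).submoduleOf (cycles K F n k i)

/-- The Betti number `dim H_{k,i}`. -/
noncomputable def betti (m : ℕ) (k : ℤ) (i : ℕ) : ℕ := finrank F (Homology K F n m k i)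

/-- Exactness (kernel equals image at every position) of the sequence `M_{k,i}`
`⋯ ← M_{k-m} ← M_{k-i} ← M_k ← M_{k+m-i} ← M_{k+m} ← ⋯`, in which the maps
`M_{k+tm} → M_{k-i+tm}` are `∂^i` and the maps `M_{k+m-i+tm} → M_{k+tm}` are `∂^(m-i)`. -/
def SeqExact (m : ℕ) (k : ℤ) (i : ℕ) : Prop :=
  ∀ t : ℤ,
    LinearMap.ker (bd K F n ^ i) ⊓ chains K F n (k + t * m) =
        (chains K F n (k + t * m + m - i)).map (bd K F n ^ (m - i)) ∧
    LinearMap.ker (bd K F n ^ (m - i)) ⊓ chains K F n (k - i + t * m) =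
        (chains K F n (k + t * m)).map (bd K F n ^ i)

/-- `(k, i) ∼ (k', i')`: the two index pairs define the same sequence, that is,
`(k', i') = (k + tm, i)` or `(k', i') = (k - i + tm, m - i)` for some integer `t`. -/
def SameSeq (m : ℕ) (k : ℤ) (i : ℕ) (k' : ℤ) (i' : ℕ) : Prop :=
  ∃ t : ℤ, (k' = k + t * m ∧ i' = i) ∨ (k' = k - i + t * m ∧ i' + i = m)

/-- `(k, i)` is a middle index for `n`. -/
def IsMiddleIndex (n m : ℕ) (k : ℤ) (i : ℕ) : Prop :=
  (0 ≤ k ∧ k ≤ n) ∧ (0 < i ∧ i < m) ∧ ((n : ℤ) < 2 * k + m - i ∧ 2 * k + m - i < (n : ℤ) + m)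

end ProjIncidence

/-! Let `q = |K|`, which is invertible in `F`, and split `K^(n+1)` as `H × K` with `H = K^n`. A
subspace is either `lo y`, inside `H × 0`, or `up y h`, given by a subspace `y` of `H` and a coset
`h + y`. For fixed `y`, a function on the subspaces `up y h` is a `y`-invariant function of `h`, and
it splits into its mean and a part with sum zero. The functions on `H` with sum zero have a basis of
`q^n - 1` elements, each invariant under a hyperplane, that is compatible with invariance under
every subspace `y` (`exists_isAdapted`). Nontrivial additive characters are the model for it, but no
roots of unity in `F` are required.

In these coordinates (`assemble_comm`) the complex of `K^(n+1)` is the direct sum of a `q`-cone over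
the complex of `K^n`, made of the values on `lo y` and the means, and of `q^n - 1` copies of the
complex of `K^(n-1)` shifted by one degree (`latticeBd_recursion`).

The cone has differential `(a, b) ↦ (d a + b, q d b)`. Its `m`-th power vanishes because `[m]_q = 0`
in `F`, so `∂^m = 0` comes out of the same induction. For `m = 2` the cone is exact
(`hdim_cone_two`). For `m = 3` its homology at `(k, 1)` and `(k, 2)` is that of `K^n` at `(k, 2)`
and `(k - 1, 1)` (`hdim_cone_three_one`, `hdim_cone_three_two`). The resulting recursions for Betti
numbers start from the zero space and give all the claims. -/

namespace ProjIncidence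

/-! ### Homology of graded `m`-complexes: isomorphisms, direct sums and the `q`-cone -/

section GradedComplex

variable {F C C' : Type*} [Field F] [AddCommGroup C] [Module F C] [AddCommGroup C'] [Module F C']

/-- Cycles `ker d^i ∩ G_k` of an endomorphism `d` with respect to a grading `G`. -/
def cyc (d : Module.End F C) (G : ℤ → Submodule F C) (k : ℤ) (i : ℕ) : Submodule F C :=
  LinearMap.ker (d ^ i) ⊓ G k

/-- Boundaries `d^(m-i) (G_(k+m-i))`. -/
def bdr (d : Module.End F C) (G : ℤ → Submodule F C) (m : ℕ) (k : ℤ) (i : ℕ) : Submodule F C :=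
  (G (k + m - i)).map (d ^ (m - i))

/-- The dimension of the homology `cyc / bdr`. -/
noncomputable def hdim (d : Module.End F C) (G : ℤ → Submodule F C) (m : ℕ) (k : ℤ) (i : ℕ) : ℕ :=
  finrank F (cyc d G k i ⧸ (bdr d G m k i).submoduleOf (cyc d G k i))

/-- An `m`-complex: `d` has degree `-1` and `d^m = 0`. -/
structure IsComplex (m : ℕ) (d : Module.End F C) (G : ℤ → Submodule F C) : Prop where
  pow_eq_zero : d ^ m = 0
  map_mem : ∀ k x, x ∈ G k → d x ∈ G (k - 1)

theorem mem_cyc {d : Module.End F C} {G : ℤ → Submodule F C} {k : ℤ} {i : ℕ} {x : C} :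
    x ∈ cyc d G k i ↔ (d ^ i) x = 0 ∧ x ∈ G k := by
  simp [cyc]

theorem mem_bdr {d : Module.End F C} {G : ℤ → Submodule F C} {m : ℕ} {k : ℤ} {i : ℕ} {x : C} :
    x ∈ bdr d G m k i ↔ ∃ y ∈ G (k + m - i), (d ^ (m - i)) y = x := by
  simp [bdr]

theorem pow_mem {m : ℕ} {d : Module.End F C} {G : ℤ → Submodule F C} (h : IsComplex m d G)
    (i : ℕ) {k : ℤ} {x : C} (hx : x ∈ G k) : (d ^ i) x ∈ G (k - i) := by
  induction i with
  | zero => simpa using hx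
  | succ i ih =>
    rw [pow_succ', Module.End.mul_apply]
    have := h.map_mem _ _ ih
    rwa [show k - (i : ℤ) - 1 = k - ((i + 1 : ℕ) : ℤ) by push_cast; ring] at this

theorem bdr_le_cyc {m : ℕ} {d : Module.End F C} {G : ℤ → Submodule F C} (h : IsComplex m d G)
    {k : ℤ} {i : ℕ} (hi : i ≤ m) : bdr d G m k i ≤ cyc d G k i := by
  intro x hx
  obtain ⟨y, hy, rfl⟩ := mem_bdr.1 hx
  refine mem_cyc.2 ⟨?_, ?_⟩
  · rw [← Module.End.mul_apply, ← pow_add, Nat.add_sub_cancel' hi, h.pow_eq_zero]; rfl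
  · have := pow_mem h (m - i) hy
    rwa [show k + (m : ℤ) - i - ((m - i : ℕ) : ℤ) = k by push_cast [hi]; ring] at this

/-- Since `ker ψ ∩ S` lies in `T`, the map `S → S' / T'` induced by `ψ` has kernel exactly `T`. This
lets homologies be compared along maps that are neither injective nor defined on a quotient. -/
theorem finrank_subquotient_eq {S T : Submodule F C} {S' T' : Submodule F C'} (ψ : C →ₗ[F] C')
    (hTS : T ≤ S) (hS : S.map ψ = S') (hT : T.map ψ = T') (hk : LinearMap.ker ψ ⊓ S ≤ T) :
    finrank F (S ⧸ T.submoduleOf S) = finrank F (S' ⧸ T'.submoduleOf S') := by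
  have hmem : ∀ x ∈ S, ψ x ∈ S' := fun x hx => hS ▸ Submodule.mem_map_of_mem hx
  let f : S →ₗ[F] S' ⧸ T'.submoduleOf S' := (T'.submoduleOf S').mkQ ∘ₗ ψ.restrict hmem
  have hsurj : Function.Surjective f := by
    refine (Submodule.mkQ_surjective _).comp ?_
    rintro ⟨y, hy⟩
    rw [← hS] at hy
    obtain ⟨x, hx, rfl⟩ := hy
    exact ⟨⟨x, hx⟩, rfl⟩
  have hker : LinearMap.ker f = T.submoduleOf S := by
    ext ⟨x, hx⟩
    have hf : f ⟨x, hx⟩ = 0 ↔ ψ x ∈ T' := Submodule.Quotient.mk_eq_zero _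
    rw [LinearMap.mem_ker, hf]
    change _ ↔ x ∈ T
    constructor
    · intro h
      rw [← hT] at h
      obtain ⟨t, ht, hxt⟩ := h
      have : x - t ∈ T := hk ⟨by simp [hxt], S.sub_mem hx (hTS ht)⟩
      simpa using T.add_mem this ht
    · intro h
      exact hT ▸ Submodule.mem_map_of_mem h
  rw [← hker]
  exact (f.quotKerEquivOfSurjective hsurj).finrank_eq

theorem finrank_subquotient_add [FiniteDimensional F C] {S T : Submodule F C} (h : T ≤ S) :
    finrank F (S ⧸ T.submoduleOf S) + finrank F T = finrank F S := by
  rw [← (Submodule.submoduleOfEquivOfLe h).finrank_eq]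
  exact Submodule.finrank_quotient_add_finrank _

theorem hdim_add_finrank_bdr [FiniteDimensional F C] {m : ℕ} {d : Module.End F C}
    {G : ℤ → Submodule F C} (h : IsComplex m d G) (k : ℤ) {i : ℕ} (hi : i ≤ m) :
    hdim d G m k i + finrank F (bdr d G m k i) = finrank F (cyc d G k i) :=
  finrank_subquotient_add (bdr_le_cyc h hi)

theorem hdim_eq_zero_iff [FiniteDimensional F C] {d : Module.End F C}
    {G : ℤ → Submodule F C} {m : ℕ} {k : ℤ} {i : ℕ} :
    hdim d G m k i = 0 ↔ cyc d G k i ≤ bdr d G m k i := by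
  rw [hdim, Module.finrank_eq_zero_iff_of_free, Submodule.Quotient.subsingleton_iff,
    Submodule.submoduleOf, Submodule.comap_subtype_eq_top]

/-! ### Isomorphic complexes -/

section Iso

variable {d : Module.End F C} {G : ℤ → Submodule F C} {d' : Module.End F C'}
  {G' : ℤ → Submodule F C'} (e : C ≃ₗ[F] C') (hd : ∀ x, e (d x) = d' (e x))

include hd in
theorem equiv_pow_apply (i : ℕ) (x : C) : e ((d ^ i) x) = (d' ^ i) (e x) := by
  induction i generalizing x with
  | zero => rfl
  | succ i ih => rw [pow_succ, pow_succ, Module.End.mul_apply, Module.End.mul_apply, ih, hd]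

variable (hG : ∀ k x, e x ∈ G' k ↔ x ∈ G k)

include hd hG in
theorem IsComplex.equiv {m : ℕ} (h : IsComplex m d G) : IsComplex m d' G' := by
  constructor
  · ext y
    obtain ⟨x, rfl⟩ := e.surjective y
    rw [← equiv_pow_apply e hd, h.pow_eq_zero]; simp
  · intro k y hy
    obtain ⟨x, rfl⟩ := e.surjective y
    rw [← hd, hG]
    exact h.map_mem k x ((hG k x).1 hy)

include hd hG in
theorem hdim_equiv {m : ℕ} (h : IsComplex m d G) (k : ℤ) {i : ℕ} (hi : i ≤ m) :
    hdim d G m k i = hdim d' G' m k i := by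
  refine finrank_subquotient_eq (e : C →ₗ[F] C') (bdr_le_cyc h hi) ?_ ?_ ?_
  · ext y
    obtain ⟨x, rfl⟩ := e.surjective y
    simp only [Submodule.mem_map, LinearEquiv.coe_coe, e.injective.eq_iff, exists_eq_right,
      mem_cyc, hG, ← equiv_pow_apply e hd, e.map_eq_zero_iff]
  · ext y
    obtain ⟨x, rfl⟩ := e.surjective y
    simp only [Submodule.mem_map, LinearEquiv.coe_coe, e.injective.eq_iff, exists_eq_right,
      mem_bdr]
    constructor
    · rintro ⟨y, hy, rfl⟩
      exact ⟨e y, (hG _ _).2 hy, (equiv_pow_apply e hd _ _).symm⟩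
    · rintro ⟨z, hz, hzx⟩
      obtain ⟨y, rfl⟩ := e.surjective z
      refine ⟨y, (hG _ _).1 hz, e.injective ?_⟩
      rw [equiv_pow_apply e hd, hzx]
  · intro x hx
    have : x = 0 := by simpa using hx.1
    simp [this]

end Iso

/-! ### Direct sums -/

section Sums

theorem prodMap_pow (d : Module.End F C) (d' : Module.End F C') (i : ℕ) :
    (LinearMap.prodMap d d' : Module.End F (C × C')) ^ i = LinearMap.prodMap (d ^ i) (d' ^ i) := by
  induction i with
  | zero => rfl
  | succ i ih => rw [pow_succ, ih, pow_succ, pow_succ]; rfl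

theorem compLeft_pow (d : Module.End F C) (X : Type*) (i : ℕ) :
    (LinearMap.compLeft d X : Module.End F (X → C)) ^ i = LinearMap.compLeft (d ^ i) X := by
  induction i with
  | zero => rfl
  | succ i ih => rw [pow_succ, ih, pow_succ]; rfl

theorem finrank_submodule_prod [FiniteDimensional F C] [FiniteDimensional F C']
    (S : Submodule F C) (S' : Submodule F C') :
    finrank F (S.prod S') = finrank F S + finrank F S' := by
  have e : S.prod S' ≃ₗ[F] S × S' :=
    { toFun := fun x => (⟨x.1.1, x.2.1⟩, ⟨x.1.2, x.2.2⟩)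
      invFun := fun x => ⟨(x.1.1, x.2.1), ⟨x.1.2, x.2.2⟩⟩
      map_add' := fun _ _ => rfl
      map_smul' := fun _ _ => rfl
      left_inv := fun _ => rfl
      right_inv := fun _ => rfl }
  rw [e.finrank_eq, Module.finrank_prod]

theorem finrank_submodule_pi [FiniteDimensional F C] (X : Type*) [Fintype X]
    (S : Submodule F C) :
    finrank F (Submodule.pi (Set.univ : Set X) fun _ => S) = Fintype.card X * finrank F S := by
  have e : Submodule.pi (Set.univ : Set X) (fun _ => S) ≃ₗ[F] (X → S) :=
    { toFun := fun x i => ⟨x.1 i, x.2 i trivial⟩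
      invFun := fun x => ⟨fun i => (x i).1, fun i _ => (x i).2⟩
      map_add' := fun _ _ => rfl
      map_smul' := fun _ _ => rfl
      left_inv := fun _ => rfl
      right_inv := fun _ => rfl }
  rw [e.finrank_eq, Module.finrank_pi_fintype]
  simp

variable [FiniteDimensional F C] [FiniteDimensional F C'] {d : Module.End F C}
  {G : ℤ → Submodule F C} {d' : Module.End F C'} {G' : ℤ → Submodule F C'} {m : ℕ}

omit [FiniteDimensional F C] [FiniteDimensional F C'] in
theorem IsComplex.prod (h : IsComplex m d G) (h' : IsComplex m d' G') :
    IsComplex m (LinearMap.prodMap d d') (fun k => (G k).prod (G' k)) := by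
  constructor
  · rw [prodMap_pow, h.pow_eq_zero, h'.pow_eq_zero]; rfl
  · exact fun k x hx => ⟨h.map_mem _ _ hx.1, h'.map_mem _ _ hx.2⟩

omit [FiniteDimensional F C] in
theorem IsComplex.pi (h : IsComplex m d G) (X : Type*) :
    IsComplex m (LinearMap.compLeft d X) (fun k => Submodule.pi Set.univ fun _ => G k) := by
  constructor
  · rw [compLeft_pow, h.pow_eq_zero]; rfl
  · exact fun k x hx i _ => h.map_mem _ _ (hx i trivial)

theorem hdim_prod (h : IsComplex m d G) (h' : IsComplex m d' G') (k : ℤ) {i : ℕ} (hi : i ≤ m) :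
    hdim (LinearMap.prodMap d d') (fun k => (G k).prod (G' k)) m k i =
      hdim d G m k i + hdim d' G' m k i := by
  have h1 := hdim_add_finrank_bdr (h.prod h') k hi
  have hc : cyc (LinearMap.prodMap d d') (fun k => (G k).prod (G' k)) k i =
      (cyc d G k i).prod (cyc d' G' k i) := by
    ext x
    simp only [mem_cyc, Submodule.mem_prod, prodMap_pow, LinearMap.prodMap_apply,
      Prod.mk_eq_zero]
    tauto
  have hb : bdr (LinearMap.prodMap d d') (fun k => (G k).prod (G' k)) m k i =
      (bdr d G m k i).prod (bdr d' G' m k i) := by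
    ext x
    simp only [mem_bdr, Submodule.mem_prod, prodMap_pow, LinearMap.prodMap_apply]
    constructor
    · rintro ⟨y, ⟨h1, h2⟩, rfl⟩
      exact ⟨⟨_, h1, rfl⟩, ⟨_, h2, rfl⟩⟩
    · rintro ⟨⟨y, hy, e1⟩, ⟨z, hz, e2⟩⟩
      exact ⟨(y, z), ⟨hy, hz⟩, Prod.ext e1 e2⟩
  rw [hc, hb, finrank_submodule_prod, finrank_submodule_prod, ← hdim_add_finrank_bdr h k hi,
    ← hdim_add_finrank_bdr h' k hi] at h1
  omega

theorem hdim_pi (h : IsComplex m d G) (X : Type*) [Fintype X] (k : ℤ) {i : ℕ} (hi : i ≤ m) :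
    hdim (LinearMap.compLeft d X) (fun k => Submodule.pi Set.univ fun _ => G k) m k i =
      Fintype.card X * hdim d G m k i := by
  have h1 := hdim_add_finrank_bdr (h.pi X) k hi
  have hc : cyc (LinearMap.compLeft d X) (fun k => Submodule.pi Set.univ fun _ => G k) k i =
      Submodule.pi Set.univ fun _ => cyc d G k i := by
    ext x
    simp only [mem_cyc, Submodule.mem_pi, compLeft_pow, funext_iff, Set.mem_univ, true_imp_iff]
    exact ⟨fun h j => ⟨h.1 j, h.2 j⟩, fun h => ⟨fun j => (h j).1, fun j => (h j).2⟩⟩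
  have hb : bdr (LinearMap.compLeft d X) (fun k => Submodule.pi Set.univ fun _ => G k) m k i =
      Submodule.pi Set.univ fun _ => bdr d G m k i := by
    ext x
    simp only [mem_bdr, Submodule.mem_pi, compLeft_pow, Set.mem_univ, true_imp_iff]
    constructor
    · rintro ⟨y, h1, rfl⟩ j
      exact ⟨_, h1 j, rfl⟩
    · intro h
      choose y hy e using h
      exact ⟨y, hy, funext e⟩
  rw [hc, hb, finrank_submodule_pi, finrank_submodule_pi, ← hdim_add_finrank_bdr h k hi,
    mul_add] at h1
  omega

omit [FiniteDimensional F C] in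
theorem IsComplex.shift (h : IsComplex m d G) : IsComplex m d (fun k => G (k - 1)) :=
  ⟨h.pow_eq_zero, fun k => h.map_mem (k - 1)⟩

omit [FiniteDimensional F C] in
theorem hdim_shift (k : ℤ) (i : ℕ) :
    hdim d (fun k => G (k - 1)) m k i = hdim d G m (k - 1) i := by
  have hb : bdr d (fun k => G (k - 1)) m k i = bdr d G m (k - 1) i := by
    simp only [bdr]
    rw [show k + (m : ℤ) - i - 1 = k - 1 + m - i by ring]
  change finrank F (cyc d G (k - 1) i ⧸ (bdr d (fun k => G (k - 1)) m k i).submoduleOf _) = _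
  rw [hb]
  rfl

end Sums

/-! ### The `q`-cone -/

section Cone

/-- The differential `(a, b) ↦ (d a + b, q d b)` on `C × C`. -/
def cone (q : F) (d : Module.End F C) : Module.End F (C × C) :=
  LinearMap.prod (d ∘ₗ LinearMap.fst F C C + LinearMap.snd F C C) (q • d ∘ₗ LinearMap.snd F C C)

/-- The grading of the `q`-cone. -/
def coneGr (G : ℤ → Submodule F C) (k : ℤ) : Submodule F (C × C) := (G k).prod (G (k - 1))

@[simp] theorem cone_apply (q : F) (d : Module.End F C) (x : C × C) :
    cone q d x = (d x.1 + x.2, q • d x.2) := rfl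

theorem mem_coneGr {G : ℤ → Submodule F C} {k : ℤ} {x : C × C} :
    x ∈ coneGr G k ↔ x.1 ∈ G k ∧ x.2 ∈ G (k - 1) := Iff.rfl

variable {d : Module.End F C} {G : ℤ → Submodule F C} {q : F}

theorem cone_map_mem {m : ℕ} (h : IsComplex m d G) (k : ℤ) (x : C × C) (hx : x ∈ coneGr G k) :
    cone q d x ∈ coneGr G (k - 1) :=
  ⟨(G _).add_mem (h.map_mem _ _ hx.1) hx.2, (G _).smul_mem _ (h.map_mem _ _ hx.2)⟩

theorem isComplex_cone_two (hq : 1 + q = 0) (h : IsComplex 2 d G) :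
    IsComplex 2 (cone q d) (coneGr G) := by
  refine ⟨?_, cone_map_mem h⟩
  have hd : ∀ x, d (d x) = 0 := fun x => by
    simpa [pow_succ] using LinearMap.congr_fun h.pow_eq_zero x
  refine LinearMap.ext fun x => ?_
  have : d x.2 + q • d x.2 = (0 : C) := by rw [show d x.2 + q • d x.2 = (1 + q) • d x.2 by rw [add_smul, one_smul], hq, zero_smul]
  simp [pow_succ, hd, this]

/-- Here `q = -1`, so a cycle has `b = -d a = q d a` and is the image of `(0, a)`. -/
theorem hdim_cone_two (hq : 1 + q = 0) (k : ℤ) [FiniteDimensional F C] : hdim (cone q d) (coneGr G) 2 k 1 = 0 := by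
  rw [hdim_eq_zero_iff]
  rintro ⟨a, b⟩ hx
  obtain ⟨h1, h2, h3⟩ := mem_cyc.1 hx
  simp only [pow_one, cone_apply, Prod.mk_eq_zero] at h1
  refine mem_bdr.2 ⟨(0, a), ⟨Submodule.zero_mem _, ?_⟩, ?_⟩
  · simpa [add_sub_assoc] using h2
  · have hq' : q = -1 := by linear_combination hq
    have hb : b = -d a := by rw [eq_neg_iff_add_eq_zero, add_comm]; exact h1.1
    simp [hb, hq']

variable (hq : 1 + q + q ^ 2 = 0)

include hq in
theorem isComplex_cone_three (h : IsComplex 3 d G) :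
    IsComplex 3 (cone q d) (coneGr G) := by
  refine ⟨?_, cone_map_mem h⟩
  have hd : ∀ x, d (d (d x)) = 0 := fun x => by
    simpa [pow_succ] using LinearMap.congr_fun h.pow_eq_zero x
  refine LinearMap.ext fun x => ?_
  have : d (d x.2) + q • d (d x.2) + q • q • d (d x.2) = (0 : C) := by
    rw [smul_smul, ← pow_two, show ∀ y : C, y + q • y + q ^ 2 • y = (1 + q + q ^ 2) • y from
      fun y => by rw [add_smul, add_smul, one_smul], hq, zero_smul]
  simp [pow_succ, hd, this]

-- A cycle has `b = -d a` and `d² a = 0`, so the first coordinate identifies the cycles with `ker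
-- d²`. The square of the cone differential has first coordinate `d (d a + (1 + q) b)`, and `1 + q =
-- -q²` is invertible, so boundaries go onto the image of `d`.
include hq in
theorem hdim_cone_three_one (h : IsComplex 3 d G) (k : ℤ) :
    hdim (cone q d) (coneGr G) 3 k 1 = hdim d G 3 k 2 := by
  have hq0 : q ≠ 0 := by rintro rfl; simp at hq
  have hd : ∀ x, d (d (d x)) = 0 := fun x => by
    simpa [pow_succ] using LinearMap.congr_fun h.pow_eq_zero x
  refine finrank_subquotient_eq (LinearMap.fst F C C)
    (bdr_le_cyc (isComplex_cone_three hq h) (by norm_num)) ?_ ?_ ?_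
  · ext a
    simp only [Submodule.mem_map, mem_cyc, LinearMap.fst_apply, Prod.exists, cone_apply,
      Prod.mk_eq_zero, mem_coneGr, pow_succ, pow_zero, one_mul, Module.End.mul_apply]
    constructor
    · rintro ⟨a, b, ⟨⟨h1, h2⟩, h3, h4⟩, rfl⟩
      have hb : b = -d a := by rw [eq_neg_iff_add_eq_zero, add_comm]; exact h1
      refine ⟨?_, h3⟩
      simpa [hb, hq0] using h2
    · rintro ⟨h1, h2⟩
      exact ⟨a, -d a, ⟨⟨by simp, by simp [h1]⟩, h2, (G _).neg_mem (h.map_mem _ _ h2)⟩, rfl⟩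
  · ext a
    simp only [Submodule.mem_map, mem_bdr, LinearMap.fst_apply, Prod.exists, cone_apply,
      mem_coneGr, pow_succ, pow_zero, one_mul, Module.End.mul_apply, map_add, Nat.reduceSub,
      map_smul]
    have e1 : k + ((3 : ℕ) : ℤ) - ((1 : ℕ) : ℤ) - 1 = k + ((3 : ℕ) : ℤ) - ((2 : ℕ) : ℤ) := by
      push_cast; ring
    rw [e1]
    constructor
    · rintro ⟨a', b', ⟨a, b, ⟨h1, h2⟩, h3⟩, rfl⟩
      refine ⟨d a + (1 + q) • b, (G _).add_mem ?_ ((G _).smul_mem _ h2), ?_⟩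
      · have := h.map_mem _ _ h1
        rwa [e1] at this
      · rw [← (Prod.mk.inj h3).1, map_add, map_smul, add_smul, one_smul, add_assoc]
    · rintro ⟨b, h2, rfl⟩
      have h1q : 1 + q = -q ^ 2 := by linear_combination hq
      have h1q' : 1 + q ≠ 0 := by rw [h1q]; simpa using hq0
      refine ⟨_, _, ⟨0, (1 + q)⁻¹ • b, ⟨Submodule.zero_mem _, (G _).smul_mem _ h2⟩, rfl⟩, ?_⟩
      rw [map_smul]
      simp only [map_zero, zero_add]
      rw [smul_smul, ← add_smul, ← one_add_mul, mul_inv_cancel₀ h1q', one_smul]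
  · rintro ⟨a, b⟩ ⟨h1, h2⟩
    have ha : a = 0 := h1
    have hb : b = 0 := by
      have := (mem_cyc.1 h2).1
      simp only [pow_one, cone_apply, Prod.mk_eq_zero, ha, map_zero, zero_add] at this
      exact this.1
    rw [ha, hb]
    exact Submodule.zero_mem _

-- The map `(a, b) ↦ b - q d a` kills exactly the pairs `(a, q d a)`, the images of `(0, a)` under
-- the cone differential, and it sends the image of `(a, b)` to `-q d² a`. Because `q³ = 1`, it
-- takes cycles into `ker d`.
include hq in
theorem hdim_cone_three_two (h : IsComplex 3 d G) (k : ℤ) :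
    hdim (cone q d) (coneGr G) 3 k 2 = hdim d G 3 (k - 1) 1 := by
  have hq0 : q ≠ 0 := by rintro rfl; simp at hq
  have hd : ∀ x, d (d (d x)) = 0 := fun x => by
    simpa [pow_succ] using LinearMap.congr_fun h.pow_eq_zero x
  have hq3 : q * q ^ 2 = 1 := by linear_combination (q - 1) * hq
  have h1q : 1 + q = -q ^ 2 := by linear_combination hq
  have e1 : k + ((3 : ℕ) : ℤ) - ((2 : ℕ) : ℤ) - 1 = k := by push_cast; ring
  have e2 : k - 1 + ((3 : ℕ) : ℤ) - ((1 : ℕ) : ℤ) = k + ((3 : ℕ) : ℤ) - ((2 : ℕ) : ℤ) := by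
    push_cast; ring
  refine finrank_subquotient_eq (LinearMap.snd F C C - q • d ∘ₗ LinearMap.fst F C C)
    (bdr_le_cyc (isComplex_cone_three hq h) (by norm_num)) ?_ ?_ ?_
  · ext c
    simp only [Submodule.mem_map, mem_cyc, LinearMap.fst_apply, LinearMap.snd_apply,
      LinearMap.sub_apply, LinearMap.smul_apply, LinearMap.comp_apply, Prod.exists,
      cone_apply, Prod.mk_eq_zero, mem_coneGr, pow_succ, pow_zero, one_mul,
      Module.End.mul_apply]
    constructor
    · rintro ⟨a, b, ⟨⟨h1, h2⟩, h3, h4⟩, rfl⟩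
      refine ⟨?_, (G _).sub_mem h4 ((G _).smul_mem _ (h.map_mem _ _ h3))⟩
      have h5 : d (d a) = q ^ 2 • d b := by
        have : d (d a) = -((1 + q) • d b) := by
          rw [eq_neg_iff_add_eq_zero, add_smul, one_smul, ← add_assoc, ← map_add]
          exact h1
        rw [this, h1q, neg_smul, neg_neg]
      rw [map_sub, map_smul, h5, smul_smul, hq3, one_smul, sub_self]
    · rintro ⟨h1, h2⟩
      exact ⟨0, c, ⟨⟨by simp [h1], by simp [h1]⟩, Submodule.zero_mem _, h2⟩, by simp⟩
  · ext c
    simp only [Submodule.mem_map, mem_bdr, LinearMap.fst_apply, LinearMap.snd_apply,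
      LinearMap.sub_apply, LinearMap.smul_apply, LinearMap.comp_apply, Prod.exists, cone_apply,
      mem_coneGr, pow_succ, pow_zero, one_mul, Module.End.mul_apply, Nat.reduceSub]
    rw [e1, e2]
    constructor
    · rintro ⟨a', b', ⟨a, b, ⟨h1, h2⟩, h3⟩, rfl⟩
      obtain ⟨rfl, rfl⟩ := Prod.mk.inj h3
      refine ⟨-q • a, (G _).smul_mem _ h1, ?_⟩
      simp
    · rintro ⟨a, h1, rfl⟩
      refine ⟨_, _, ⟨-q⁻¹ • a, 0, ⟨(G _).smul_mem _ h1, Submodule.zero_mem _⟩, rfl⟩, ?_⟩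
      simp [smul_smul, hq0]
  · rintro ⟨a, b⟩ ⟨h1, h2⟩
    have hb : b = q • d a := by
      rw [← sub_eq_zero]; simpa using h1
    refine mem_bdr.2 ⟨(0, a), ⟨Submodule.zero_mem _, ?_⟩, ?_⟩
    · change a ∈ G (_ - 1)
      rw [e1]
      exact (mem_cyc.1 h2).2.1
    · simp [hb]

end Cone

end GradedComplex

/-! ### Subspaces of `H × K` and the incidence map on them -/

section Lattice

variable {K : Type*} [Field K] [Finite K]

/-- The set of subspaces of a finite vector space, as a fintype. -/
noncomputable local instance fintypeSubmodule (V : Type*) [AddCommGroup V] [Module K V] [Finite V] :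
    Fintype (Submodule K V) := Fintype.ofFinite _

open Classical in
/-- The incidence map on functions on subspaces of `V`: the value at `y` is the sum over the upper
covers of `y`. -/
noncomputable def latticeBd (K F : Type*) [Field K] [Finite K] [Field F] (V : Type*)
    [AddCommGroup V] [Module K V] [Finite V] : Module.End F (Submodule K V → F) where
  toFun f y := ∑ x, if y ≤ x ∧ finrank K y + 1 = finrank K x then f x else 0
  map_add' f g := by
    ext y
    simp only [Pi.add_apply, ← Finset.sum_add_distrib]
    exact Finset.sum_congr rfl fun x _ => by split_ifs <;> simp
  map_smul' c f := by
    ext y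
    simp only [Pi.smul_apply, RingHom.id_apply, Finset.smul_sum]
    exact Finset.sum_congr rfl fun x _ => by split_ifs <;> simp

open Classical in
theorem latticeBd_apply {F V : Type*} [Field F] [AddCommGroup V] [Module K V] [Finite V]
    (f : Submodule K V → F) (y : Submodule K V) :
    latticeBd K F V f y = ∑ x, if y ≤ x ∧ finrank K y + 1 = finrank K x then f x else 0 := rfl

/-- The functions supported on `k`-dimensional subspaces. -/
def latticeGr (K F : Type*) [Field K] [Field F] (V : Type*) [AddCommGroup V] [Module K V] (k : ℤ) :
    Submodule F (Submodule K V → F) where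
  carrier := {f | ∀ x : Submodule K V, (finrank K x : ℤ) ≠ k → f x = 0}
  add_mem' hf hg x hx := by simp [hf x hx, hg x hx]
  zero_mem' _ _ := rfl
  smul_mem' c f hf x hx := by simp [hf x hx]

/-- Summing over lower covers of basis elements becomes, on coefficient functions, summing over
upper covers. -/
theorem bd_eq_latticeBd (F : Type*) [Field F] (n : ℕ) :
    bd K F n = latticeBd K F (Fin n → K) := by
  classical
  refine (Pi.basisFun F (ProjSpace K n)).ext fun x => ?_
  rw [bd, Basis.constr_basis]
  ext y
  simp only [latticeBd, LinearMap.coe_mk, AddHom.coe_mk, Pi.basisFun_apply, Finset.sum_apply,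
    Pi.single_apply]
  rw [Finset.sum_ite_eq, Finset.sum_eq_single x (fun z _ hz => by simp [hz]) (by simp)]
  simp

variable {F : Type*} [Field F] {H : Type*} [AddCommGroup H] [Module K H]

/-- The subspace `y × 0` of `H × K`. -/
def lo (y : Submodule K H) : Submodule K (H × K) := y.map (LinearMap.inl K H K)

/-- The subspace `y × 0 + ⟨(h, 1)⟩` of `H × K`. -/
def up (y : Submodule K H) (h : H) : Submodule K (H × K) :=
  y.comap (LinearMap.fst K H K - (LinearMap.snd K H K).smulRight h)

omit [Finite K] in
theorem mem_lo {y : Submodule K H} {v : H × K} : v ∈ lo y ↔ v.1 ∈ y ∧ v.2 = 0 := by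
  simp only [lo, Submodule.mem_map, LinearMap.inl_apply]
  constructor
  · rintro ⟨w, hw, rfl⟩
    exact ⟨hw, rfl⟩
  · rintro ⟨h1, h2⟩
    exact ⟨v.1, h1, Prod.ext rfl h2.symm⟩

omit [Finite K] in
theorem mem_up {y : Submodule K H} {h : H} {v : H × K} : v ∈ up y h ↔ v.1 - v.2 • h ∈ y := by
  simp [up]

omit [Finite K] in
theorem finrank_lo (y : Submodule K H) : finrank K (lo y) = finrank K y :=
  (Submodule.equivMapOfInjective _ LinearMap.inl_injective y).finrank_eq.symm

omit [Finite K] in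
theorem finrank_up [Module.Finite K H] (y : Submodule K H) (h : H) :
    finrank K (up y h) = finrank K y + 1 := by
  have e : up y h ≃ₗ[K] y × K :=
    { toFun := fun v => (⟨v.1.1 - v.1.2 • h, mem_up.1 v.2⟩, v.1.2)
      invFun := fun w => ⟨(w.1 + w.2 • h, w.2), mem_up.2 (by simp)⟩
      map_add' := fun v w => by
        refine Prod.ext (Subtype.ext ?_) rfl
        simp only [Submodule.coe_add, Prod.fst_add, Prod.snd_add]
        module
      map_smul' := fun c v => by
        refine Prod.ext (Subtype.ext ?_) rfl
        simp [smul_sub, smul_smul]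
      left_inv := fun v => by simp
      right_inv := fun w => by simp }
  rw [e.finrank_eq, Module.finrank_prod, Module.finrank_self]

omit [Finite K] in
theorem lo_le_lo {y y' : Submodule K H} : lo y ≤ lo y' ↔ y ≤ y' :=
  Submodule.map_le_map_iff_of_injective LinearMap.inl_injective _ _

omit [Finite K] in
theorem lo_le_up {y y' : Submodule K H} {h : H} : lo y ≤ up y' h ↔ y ≤ y' := by
  constructor
  · intro hle v hv
    have := mem_up.1 (hle (mem_lo.2 ⟨hv, rfl⟩ : (v, (0 : K)) ∈ lo y))
    simpa using this
  · intro hle v hv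
    obtain ⟨h1, h2⟩ := mem_lo.1 hv
    exact mem_up.2 (by simpa [h2] using hle h1)

omit [Finite K] in
theorem not_up_le_lo {y y' : Submodule K H} {h : H} : ¬ up y h ≤ lo y' := fun hle => by
  have := (mem_lo.1 (hle (mem_up.2 (by simp) : (h, (1 : K)) ∈ up y h))).2
  simp at this

omit [Finite K] in
theorem up_le_up {y y' : Submodule K H} {h h' : H} :
    up y h ≤ up y' h' ↔ y ≤ y' ∧ h - h' ∈ y' := by
  constructor
  · intro hle
    constructor
    · intro v hv
      have := mem_up.1 (hle (mem_up.2 (by simpa using hv) : (v, (0 : K)) ∈ up y h))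
      simpa using this
    · have := mem_up.1 (hle (mem_up.2 (by simp) : (h, (1 : K)) ∈ up y h))
      simpa using this
  · rintro ⟨h1, h2⟩ v hv
    rw [mem_up] at hv ⊢
    have := y'.add_mem (h1 hv) (y'.smul_mem v.2 h2)
    rwa [smul_sub, sub_add_sub_cancel] at this

omit [Finite K] in
theorem up_eq_up {y y' : Submodule K H} {h h' : H} : up y h = up y' h' ↔ y = y' ∧ h - h' ∈ y' := by
  rw [le_antisymm_iff, up_le_up, up_le_up]
  constructor
  · rintro ⟨⟨h1, h2⟩, h3, h4⟩
    exact ⟨le_antisymm h1 h3, h2⟩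
  · rintro ⟨rfl, h2⟩
    exact ⟨⟨le_rfl, h2⟩, le_rfl, by rw [← neg_sub]; exact y.neg_mem h2⟩

omit [Finite K] in
theorem lo_injective : Function.Injective (lo : Submodule K H → Submodule K (H × K)) :=
  fun _ _ h => le_antisymm (lo_le_lo.1 h.le) (lo_le_lo.1 h.ge)

omit [Finite K] in
theorem eq_up_of_mem {x : Submodule K (H × K)} {h : H} (hx : (h, (1 : K)) ∈ x) :
    x = up (x.comap (LinearMap.inl K H K)) h := by
  ext v
  have hv : (v.1 - v.2 • h, (0 : K)) = v - v.2 • (h, (1 : K)) := by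
    ext <;> simp
  rw [mem_up, Submodule.mem_comap, LinearMap.inl_apply, hv]
  exact (Submodule.sub_mem_iff_left x (x.smul_mem _ hx)).symm

omit [Finite K] in
theorem eq_lo_of_forall_notMem {x : Submodule K (H × K)} (hx : ∀ h : H, (h, (1 : K)) ∉ x) :
    x = lo (x.comap (LinearMap.inl K H K)) := by
  ext v
  rw [mem_lo, Submodule.mem_comap, LinearMap.inl_apply]
  constructor
  · intro hv
    have h2 : v.2 = 0 := by
      by_contra h0
      apply hx (v.2⁻¹ • v.1)
      have := x.smul_mem v.2⁻¹ hv
      rwa [show v.2⁻¹ • v = (v.2⁻¹ • v.1, (1 : K)) from Prod.ext rfl (by simp [h0])] at this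
    exact ⟨by rwa [← h2], h2⟩
  · rintro ⟨h1, h2⟩
    rwa [← h2] at h1

omit [Finite K] in
theorem eq_lo_or_eq_up (x : Submodule K (H × K)) : (∃ y, x = lo y) ∨ ∃ y h, x = up y h := by
  by_cases hx : ∃ h : H, (h, (1 : K)) ∈ x
  · obtain ⟨h, hh⟩ := hx
    exact Or.inr ⟨_, h, eq_up_of_mem hh⟩
  · push Not at hx
    exact Or.inl ⟨_, eq_lo_of_forall_notMem hx⟩

omit [Finite K] in
theorem natCard_submodule_ne_zero [Finite H] (hK : (Nat.card K : F) ≠ 0) (y : Submodule K H) :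
    (Nat.card y : F) ≠ 0 := by
  rw [Module.natCard_eq_pow_finrank (K := K), Nat.cast_pow]
  exact pow_ne_zero _ hK

omit [Finite K] in
theorem card_filter_sub_mem [Fintype H] (y : Submodule K H) (h : H)
    [DecidablePred fun h' => h - h' ∈ y] :
    (Finset.univ.filter fun h' => h - h' ∈ y).card = Nat.card y := by
  rw [← Fintype.card_subtype, ← Nat.card_eq_fintype_card]
  refine Nat.card_congr ⟨fun a => ⟨h - a.1, a.2⟩, fun b => ⟨h - b.1, by simp⟩, fun a => ?_,
    fun b => ?_⟩ <;> simp

/-- As `h` runs over `H`, each subspace `up y h` occurs once for every element of its coset, that is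
`|y|` times; hence the weight `|y|⁻¹`. -/
theorem sum_submodule_prod [Fintype H] (hK : (Nat.card K : F) ≠ 0)
    (g : Submodule K (H × K) → F) :
    ∑ x, g x = ∑ y, g (lo y) + ∑ y : Submodule K H, (Nat.card y : F)⁻¹ * ∑ h, g (up y h) := by
  classical
  have h1 : ∑ y, g (lo y) = ∑ x, (∑ y : Submodule K H, if x = lo y then 1 else 0) * g x := by
    simp only [Finset.sum_mul, ite_mul, one_mul, zero_mul]
    rw [Finset.sum_comm]
    simp
  have h2 : ∑ y : Submodule K H, (Nat.card y : F)⁻¹ * ∑ h, g (up y h) =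
      ∑ x, (∑ y : Submodule K H, (Nat.card y : F)⁻¹ * ∑ h, if x = up y h then 1 else 0) * g x := by
    simp only [Finset.sum_mul, Finset.mul_sum]
    rw [Finset.sum_comm (s := (Finset.univ : Finset (Submodule K (H × K))))]
    refine Finset.sum_congr rfl fun y _ => ?_
    rw [Finset.sum_comm]
    simp
  rw [h1, h2, ← Finset.sum_add_distrib]
  refine Finset.sum_congr rfl fun x _ => ?_
  rw [← add_mul]
  convert (one_mul _).symm
  obtain ⟨y, rfl⟩ | ⟨y, h, rfl⟩ := eq_lo_or_eq_up x
  · have : ∀ (y' : Submodule K H) h, lo y ≠ up y' h := fun y' h e => not_up_le_lo e.ge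
    simp [this, lo_injective.eq_iff]
  · have : ∀ (y' : Submodule K H), up y h ≠ lo y' := fun y' e => not_up_le_lo e.le
    simp only [this, if_false, Finset.sum_const_zero, zero_add, up_eq_up]
    rw [Finset.sum_eq_single y (fun z _ hz => by simp [hz.symm]) (by simp)]
    simp only [true_and, Finset.sum_boole]
    rw [card_filter_sub_mem, inv_mul_cancel₀ (natCard_submodule_ne_zero hK y)]

theorem latticeBd_lo [Fintype H] (hK : (Nat.card K : F) ≠ 0) (f : Submodule K (H × K) → F)
    (y : Submodule K H) :
    latticeBd K F (H × K) f (lo y) =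
      latticeBd K F H (fun y => f (lo y)) y + (Nat.card y : F)⁻¹ * ∑ h, f (up y h) := by
  classical
  rw [latticeBd_apply, latticeBd_apply, sum_submodule_prod hK]
  simp only [lo_le_lo, finrank_lo, lo_le_up, finrank_up]
  congr 1
  -- Among the subspaces `up z h`, those covering `lo y` are the ones with `z = y`, by dimension.
  · rw [Finset.sum_eq_single y _ (by simp)]
    · simp
    · intro z _ hz
      rw [Finset.sum_eq_zero, mul_zero]
      intro h _
      rw [if_neg]
      rintro ⟨h1, h2⟩
      exact hz (Submodule.eq_of_le_of_finrank_eq h1 (by omega)).symm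

theorem latticeBd_up [Fintype H] (hK : (Nat.card K : F) ≠ 0) (f : Submodule K (H × K) → F)
    (y : Submodule K H) (h : H) :
    latticeBd K F (H × K) f (up y h) = latticeBd K F H (fun y => f (up y h)) y := by
  classical
  rw [latticeBd_apply, latticeBd_apply, sum_submodule_prod hK]
  simp only [not_up_le_lo, up_le_up, finrank_up, false_and, if_false, Finset.sum_const_zero,
    zero_add, add_left_inj]
  refine Finset.sum_congr rfl fun y' _ => ?_
  by_cases hy : y ≤ y' ∧ finrank K y + 1 = finrank K y'
  · simp only [hy, true_and, and_true]
    -- Above `up y h` there is only one subspace over a given `y'`, namely `up y' h`; it is counted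
    -- `|y'|` times, which cancels the weight.
    have : ∀ h', (if h - h' ∈ y' then f (up y' h') else 0) =
        if h - h' ∈ y' then f (up y' h) else 0 := fun h' => by
      split_ifs with hh
      · rw [up_eq_up.2 ⟨rfl, hh⟩]
      · rfl
    rw [Finset.sum_congr rfl fun h' _ => this h', ← Finset.sum_filter, Finset.sum_const,
      card_filter_sub_mem, nsmul_eq_mul, inv_mul_cancel_left₀ (natCard_submodule_ne_zero hK y')]
    simp
  · rw [if_neg hy, Finset.sum_eq_zero, mul_zero]
    intro h' _
    rw [if_neg]
    tauto

end Lattice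

/-! ### An adapted basis of the functions with sum zero, built from hyperplanes -/

section Family

universe u

variable {K F : Type*} [Field K] [Finite K] [Field F] {H : Type u} [AddCommGroup H] [Module K H]
  [Fintype H]

attribute [local instance] fintypeSubmodule

/-- A basis `u` of the space of functions on `H` with sum zero, in which every `u χ` is invariant
under the range of `ι χ`, such that, for every subspace `y`, the functions invariant under `y`
are spanned by the `u χ` with `y ≤ range (ι χ)`. -/
structure IsAdapted {L X : Type*} [AddCommGroup L] [Module K L] [Fintype X] (ι : X → L →ₗ[K] H)
    (u : X → H → F) : Prop where
  injective : ∀ χ, Function.Injective (ι χ)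
  apply_add : ∀ χ z h, u χ (h + ι χ z) = u χ h
  sum_eq_zero : ∀ χ, ∑ h, u χ h = 0
  linearIndependent : LinearIndependent F u
  exists_coeff : ∀ (y : Submodule K H) (f : H → F), (∀ z ∈ y, ∀ h, f (h + z) = f h) →
    ∑ h, f h = 0 →
      ∃ c : X → F, (∀ χ, ¬ y ≤ LinearMap.range (ι χ) → c χ = 0) ∧ f = ∑ χ, c χ • u χ

/-- The functions on `H` that are invariant under `L` and have sum zero. -/
def invSumZero (F : Type*) [Field F] (L : Submodule K H) : Submodule F (H → F) where
  carrier := {u | (∀ z ∈ L, ∀ h, u (h + z) = u h) ∧ ∑ h, u h = 0}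
  add_mem' hu hv := ⟨fun z hz h => by simp [hu.1 z hz, hv.1 z hz],
    by simp [Finset.sum_add_distrib, hu.2, hv.2]⟩
  zero_mem' := ⟨fun _ _ _ => rfl, by simp⟩
  smul_mem' c u hu := ⟨fun z hz h => by simp [hu.1 z hz], by simp [← Finset.mul_sum, hu.2]⟩

open Classical in
/-- The sum over the translates by elements of `L`. -/
noncomputable def transSum (F : Type*) [Field F] (L : Submodule K H) : Module.End F (H → F) where
  toFun w h := ∑ l, if l ∈ L then w (h + l) else 0
  map_add' f g := by
    ext y
    simp only [Pi.add_apply, ← Finset.sum_add_distrib]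
    exact Finset.sum_congr rfl fun x _ => by split_ifs <;> simp
  map_smul' c f := by
    ext y
    simp only [Pi.smul_apply, RingHom.id_apply, Finset.smul_sum]
    exact Finset.sum_congr rfl fun x _ => by split_ifs <;> simp

open Classical in
omit [Finite K] in
theorem transSum_apply (L : Submodule K H) (w : H → F) (h : H) :
    transSum F L w h = ∑ l, if l ∈ L then w (h + l) else 0 := rfl

omit [Finite K] in
theorem transSum_apply_add (L : Submodule K H) (w : H → F) {z : H} (hz : z ∈ L) (h : H) :
    transSum F L w (h + z) = transSum F L w h := by
  classical
  rw [transSum_apply, transSum_apply]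
  refine Fintype.sum_equiv (Equiv.addLeft z) _ _ fun l => ?_
  simp only [Equiv.coe_addLeft, Submodule.add_mem_iff_right L hz, add_assoc]

omit [Finite K] in
theorem sum_transSum (L : Submodule K H) {w : H → F} (hw : ∑ h, w h = 0) :
    ∑ h, transSum F L w h = 0 := by
  classical
  simp only [transSum_apply]
  rw [Finset.sum_comm]
  refine Finset.sum_eq_zero fun l _ => ?_
  split_ifs
  · rw [← hw]
    exact Fintype.sum_equiv (Equiv.addRight l) _ _ fun h => rfl
  · simp

omit [Finite K] in
theorem transSum_mem (L : Submodule K H) {w : H → F} (hw : ∑ h, w h = 0) :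
    transSum F L w ∈ invSumZero F L :=
  ⟨fun _ hz h => transSum_apply_add L w hz h, sum_transSum L hw⟩

omit [Finite K] in
theorem sum_ite_mem (L : Submodule K H) {w : H → F}
    (hw : ∀ z ∈ L, ∀ h, w (h + z) = w h) (h : H) [DecidablePred (· ∈ L)] :
    (∑ l, if l ∈ L then w (h + l) else 0) = Nat.card L * w h := by
  have : ∀ l, (if l ∈ L then w (h + l) else 0) = if l ∈ L then w h else 0 := fun l => by
    split_ifs with hl
    · exact hw l hl h
    · rfl
  rw [Finset.sum_congr rfl fun l _ => this l, ← Finset.sum_filter, Finset.sum_const, nsmul_eq_mul,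
    ← Fintype.card_subtype, ← Nat.card_eq_fintype_card]

omit [Finite K] in
theorem transSum_eq_smul (L : Submodule K H) {w : H → F} (hw : w ∈ invSumZero F L) :
    transSum F L w = (Nat.card L : F) • w := by
  classical
  ext h
  rw [transSum_apply, sum_ite_mem L hw.1]
  rfl

-- The translate sum over `L'` is invariant under both `L` and `L'`, hence constant. Its total is
-- zero and `|H|` is invertible, so the constant is zero.
omit [Finite K] in
theorem transSum_eq_zero (hK : (Nat.card K : F) ≠ 0) {L L' : Submodule K H} (hL : L ⊔ L' = ⊤)
    {w : H → F} (hw : w ∈ invSumZero F L) : transSum F L' w = 0 := by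
  classical
  have hconst : ∀ h, transSum F L' w h = transSum F L' w 0 := by
    intro h
    obtain ⟨a, ha, b, hb, rfl⟩ := Submodule.mem_sup.1 (hL ▸ Submodule.mem_top : h ∈ L ⊔ L')
    rw [transSum_apply_add L' w hb, transSum_apply, transSum_apply]
    refine Finset.sum_congr rfl fun l _ => ?_
    rw [add_comm a l, zero_add, hw.1 a ha]
  have hsum := sum_transSum L' hw.2
  rw [Finset.sum_congr rfl fun h _ => hconst h, Finset.sum_const, nsmul_eq_mul, mul_eq_zero] at hsum
  have hcard : (Nat.card (⊤ : Submodule K H) : F) ≠ 0 := natCard_submodule_ne_zero hK ⊤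
  rw [Nat.card_congr (Submodule.topEquiv (R := K) (M := H)).toEquiv, Nat.card_eq_fintype_card]
    at hcard
  ext h
  rw [hconst]
  exact hsum.resolve_left hcard

omit [Finite K] in
theorem sup_eq_top_of_finrank {n : ℕ} (hH : finrank K H = n + 1) {L L' : Submodule K H}
    (hL : finrank K L = n) (hL' : finrank K L' = n) (hne : L ≠ L') : L ⊔ L' = ⊤ := by
  have hlt : L < L ⊔ L' := by
    refine lt_of_le_of_ne le_sup_left fun h => hne ?_
    have : L' ≤ L := by rw [h]; exact le_sup_right
    exact (Submodule.eq_of_le_of_finrank_eq this (hL'.trans hL.symm)).symm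
  have := Submodule.finrank_lt_finrank_of_lt hlt
  exact Submodule.eq_top_of_finrank_eq (le_antisymm (Submodule.finrank_le _) (by omega))

omit [Finite K] in
theorem natCard_ker_of_surjective {V : Type*} [AddCommGroup V] [Module K V] [Module.Finite K V]
    (φ : V →ₗ[K] K) (hφ : Function.Surjective φ) :
    Nat.card (LinearMap.ker φ) = Nat.card K ^ (finrank K V - 1) := by
  have hrank := φ.finrank_range_add_finrank_ker
  rw [LinearMap.range_eq_top.2 hφ, finrank_top, Module.finrank_self] at hrank
  rw [Module.natCard_eq_pow_finrank (K := K), ← hrank, Nat.add_sub_cancel_left]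

omit [Finite K] in
/-- The number of hyperplanes through `y` that avoid a vector outside `y`. -/
theorem card_hyperplanes {n : ℕ} (hH : finrank K H = n + 1) {y : Submodule K H} {l : H}
    (hl : l ∉ y) :
    Nat.card {L : Submodule K H // finrank K L = n ∧ y ≤ L ∧ l ∉ L} =
      Nat.card K ^ (finrank K y.dualAnnihilator - 1) := by
  -- Each hyperplane avoiding `l` is the kernel of a unique functional with value 1 at `l`. Those
  -- that vanish on `y` form a translate, by `φ₀`, of the kernel of evaluation at `l` on the
  -- annihilator of `y`.
  let ev : y.dualAnnihilator →ₗ[K] K := (Dual.eval K H l) ∘ₗ y.dualAnnihilator.subtype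
  have hev : ∀ φ, ev φ = φ.1 l := fun _ => rfl
  have hsep : ∀ L : Submodule K H, l ∉ L → ∃ φ : Dual K H, φ l = 1 ∧ L ≤ LinearMap.ker φ := by
    intro L hL
    obtain ⟨φ, h1, h2⟩ := Submodule.exists_le_ker_of_notMem hL
    refine ⟨(φ l)⁻¹ • φ, by simp [h1], fun v hv => ?_⟩
    have : φ v = 0 := h2 hv
    simp [this]
  obtain ⟨φ₀, h0, h0y⟩ := hsep y hl
  have h0mem : φ₀ ∈ y.dualAnnihilator := (Submodule.mem_dualAnnihilator _).2 fun w hw => h0y hw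
  have hrange : LinearMap.range ev = ⊤ := LinearMap.range_eq_top.2 fun c =>
    ⟨⟨c • φ₀, Submodule.smul_mem _ _ h0mem⟩, by simp [hev, h0]⟩
  refine Eq.trans ?_ (natCard_ker_of_surjective (V := y.dualAnnihilator) ev
    (LinearMap.range_eq_top.1 hrange))
  symm
  have hker : ∀ φ : Dual K H, φ l = 1 → finrank K (LinearMap.ker φ) = n := by
    intro φ hφ
    have h1 := φ.finrank_range_add_finrank_ker
    have h2 : LinearMap.range φ = ⊤ := LinearMap.range_eq_top.2 fun c => ⟨c • l, by simp [hφ]⟩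
    rw [h2, finrank_top, Module.finrank_self] at h1
    omega
  have hone : ∀ φ : LinearMap.ker ev, (φ.1.1 + φ₀) l = 1 := fun φ => by
    have : φ.1.1 l = 0 := φ.2
    simp [this, h0]
  refine Nat.card_congr (Equiv.ofBijective (fun φ => ⟨LinearMap.ker (φ.1.1 + φ₀), hker _ (hone φ),
    fun w hw => ?_, ?_⟩) ⟨?_, ?_⟩)
  · have h1 : φ.1.1 w = 0 := (Submodule.mem_dualAnnihilator _).1 φ.1.2 w hw
    have h2 : φ₀ w = 0 := h0y hw
    simp [h1, h2]
  · rw [LinearMap.mem_ker, hone]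
    exact one_ne_zero
  · intro φ ψ h
    have h' : LinearMap.ker (φ.1.1 + φ₀) = LinearMap.ker (ψ.1.1 + φ₀) := congrArg Subtype.val h
    refine Subtype.ext (Subtype.ext (add_right_cancel (b := φ₀) (LinearMap.ext fun v => ?_)))
    -- The kernel recovers the functional: its value at `v` is the scalar `c` for which `v - c • l`
    -- lies in the kernel.
    have h1 : v - (φ.1.1 + φ₀) v • l ∈ LinearMap.ker (φ.1.1 + φ₀) := by
      rw [LinearMap.mem_ker, map_sub, map_smul, hone, smul_eq_mul, mul_one, sub_self]
    rw [h', LinearMap.mem_ker, map_sub, map_smul, hone, smul_eq_mul, mul_one, sub_eq_zero] at h1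
    exact h1.symm
  · rintro ⟨L, h1, h2, h3⟩
    obtain ⟨φ, hφ, hL⟩ := hsep L h3
    have hmem : φ - φ₀ ∈ y.dualAnnihilator := Submodule.sub_mem _
      ((Submodule.mem_dualAnnihilator _).2 fun w hw => hL (h2 hw)) h0mem
    refine ⟨⟨⟨φ - φ₀, hmem⟩, ?_⟩, Subtype.ext ?_⟩
    · rw [LinearMap.mem_ker, hev]
      simp [hφ, h0]
    · simp only [sub_add_cancel]
      exact (Submodule.eq_of_le_of_finrank_eq hL (h1.trans (hker φ hφ).symm)).symm

-- As `f` has sum zero, its translate sum over `L` is minus the sum over the complement of `L`. A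
-- vector outside `y` is avoided by the same number of hyperplanes through `y`, and a vector in `y`
-- by none, so the total is a multiple of the translate sum over `y`. For `y = ⊤` the exponent is
-- truncated to 0, harmlessly, since both sides vanish.
omit [Finite K] in
theorem sum_transSum_hyperplanes {n : ℕ} (hH : finrank K H = n + 1) (y : Submodule K H)
    {f : H → F} (hf : f ∈ invSumZero F y) [DecidablePred fun L : Submodule K H => y ≤ L]
    [Fintype {L : Submodule K H // finrank K L = n}] :
    (∑ L : {L : Submodule K H // finrank K L = n}, if y ≤ L.1 then transSum F L.1 f else 0) =
      ((Nat.card K : F) ^ (finrank K y.dualAnnihilator - 1) * Nat.card y) • f := by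
  classical
  set c : F := (Nat.card K : F) ^ (finrank K y.dualAnnihilator - 1) with hc
  ext h
  have hfh : ∑ l, f (h + l) = 0 := by
    rw [← hf.2]
    exact Fintype.sum_equiv (Equiv.addLeft h) _ _ fun _ => rfl
  have hcompl : ∀ L : Submodule K H, transSum F L f h = -∑ l, if l ∉ L then f (h + l) else 0 := by
    intro L
    rw [eq_neg_iff_add_eq_zero, transSum_apply, ← Finset.sum_add_distrib]
    refine Eq.trans ?_ hfh
    exact Finset.sum_congr rfl fun l _ => by by_cases hl : l ∈ L <;> simp [hl]
  have hcount : ∀ l, (∑ L : {L : Submodule K H // finrank K L = n},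
      if y ≤ L.1 ∧ l ∉ L.1 then (1 : F) else 0) = if l ∉ y then c else 0 := by
    intro l
    by_cases hl : l ∈ y
    · rw [if_neg (not_not.2 hl)]
      refine Finset.sum_eq_zero fun L _ => if_neg ?_
      rintro ⟨h1, h2⟩
      exact h2 (h1 hl)
    · rw [if_pos hl, Finset.sum_boole, ← Fintype.card_subtype, hc, ← Nat.cast_pow,
        ← card_hyperplanes hH hl, ← Nat.card_eq_fintype_card]
      congr 1
      exact Nat.card_congr (Equiv.subtypeSubtypeEquivSubtypeInter _
        (fun L : Submodule K H => y ≤ L ∧ l ∉ L))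
  calc (∑ L : {L : Submodule K H // finrank K L = n}, if y ≤ L.1 then transSum F L.1 f else 0) h
      = ∑ L : {L : Submodule K H // finrank K L = n},
          -∑ l, (if y ≤ L.1 ∧ l ∉ L.1 then (1 : F) else 0) * f (h + l) := by
        rw [Finset.sum_apply]
        refine Finset.sum_congr rfl fun L _ => ?_
        by_cases hL : y ≤ L.1
        · simp [hL, hcompl]
        · simp [hL]
    _ = -∑ l, (if l ∉ y then c else 0) * f (h + l) := by
        rw [Finset.sum_neg_distrib, Finset.sum_comm]
        simp only [← Finset.sum_mul, hcount]
    _ = c * transSum F y f h := by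
        rw [hcompl, mul_neg, Finset.mul_sum]
        congr 1
        exact Finset.sum_congr rfl fun l _ => by split_ifs <;> simp
    _ = _ := by
        rw [transSum_eq_smul y hf, Pi.smul_apply, Pi.smul_apply, smul_eq_mul, smul_eq_mul, mul_assoc]

-- The basis is the union, over all hyperplanes `L`, of bases of the `L`-invariant functions with
-- sum zero. Translate sums separate the hyperplanes, which gives independence;
-- `sum_transSum_hyperplanes` expresses a `y`-invariant function through hyperplanes containing `y`,
-- which gives the adapted expansion.
omit [Finite K] in
theorem exists_isAdapted (hK : (Nat.card K : F) ≠ 0) {n : ℕ} (hH : finrank K H = n + 1) :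
    ∃ (X : Type u) (_ : Fintype X) (ι : X → (Fin n → K) →ₗ[K] H) (u : X → H → F),
      IsAdapted ι u := by
  classical
  let P := {L : Submodule K H // finrank K L = n}
  let X := Σ L : P, Fin (finrank F (invSumZero F L.1))
  let bas : ∀ L : P, Basis (Fin (finrank F (invSumZero F L.1))) F (invSumZero F L.1) :=
    fun L => finBasis F _
  let u : X → H → F := fun χ => (bas χ.1 χ.2).1
  let eqv : ∀ L : P, (Fin n → K) ≃ₗ[K] L.1 := fun L =>
    LinearEquiv.ofFinrankEq _ _ (by rw [Module.finrank_fin_fun]; exact L.2.symm)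
  let ι : X → (Fin n → K) →ₗ[K] H := fun χ => χ.1.1.subtype ∘ₗ (eqv χ.1 : (Fin n → K) →ₗ[K] χ.1.1)
  have hrange : ∀ χ, LinearMap.range (ι χ) = χ.1.1 := fun χ => by
    simp only [ι, LinearMap.range_comp, LinearEquiv.range, Submodule.map_top,
      Submodule.range_subtype]
  refine ⟨X, inferInstance, ι, u, ?_, ?_, ?_, ?_, ?_⟩
  · exact fun χ => χ.1.1.injective_subtype.comp (eqv χ.1).injective
  · exact fun χ z h => (bas χ.1 χ.2).2.1 _ (hrange χ ▸ LinearMap.mem_range_self _ z) h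
  · exact fun χ => (bas χ.1 χ.2).2.2
  · rw [Fintype.linearIndependent_iff]
    intro g hg
    let z : ∀ L : P, invSumZero F L.1 := fun L => ∑ j, g ⟨L, j⟩ • bas L j
    have hz : ∑ L, (z L).1 = 0 := by
      rw [← hg, Fintype.sum_sigma]
      refine Finset.sum_congr rfl fun L _ => ?_
      simp [z, u]
    have hz0 : ∀ L, z L = 0 := by
      intro L
      -- The translate sum over `L` multiplies the component of `L` by `|L|` and kills the others,
      -- because two distinct hyperplanes span `H`.
      have h1 := congrArg (transSum F L.1) hz
      rw [map_sum, map_zero, Finset.sum_eq_single L, transSum_eq_smul _ (z L).2] at h1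
      · exact Subtype.ext ((smul_eq_zero.1 h1).resolve_left (natCard_submodule_ne_zero hK _))
      · intro L' _ hne
        exact transSum_eq_zero hK
          (sup_eq_top_of_finrank hH L'.2 L.2 fun h => hne (Subtype.ext h)) (z L').2
      · simp
    rintro ⟨L, j⟩
    exact Fintype.linearIndependent_iff.1 (bas L).linearIndependent _ (hz0 L) j
  · intro y f hf hs
    have hfy : f ∈ invSumZero F y := ⟨hf, hs⟩
    let a : F := (Nat.card K : F) ^ (finrank K y.dualAnnihilator - 1) * Nat.card y
    have ha : a ≠ 0 := mul_ne_zero (pow_ne_zero _ hK) (natCard_submodule_ne_zero hK y)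
    let t : ∀ L : P, invSumZero F L.1 := fun L => ⟨transSum F L.1 f, transSum_mem L.1 hs⟩
    refine ⟨fun χ => if y ≤ χ.1.1 then a⁻¹ * (bas χ.1).repr (t χ.1) χ.2 else 0, fun χ hχ => ?_, ?_⟩
    · rw [hrange] at hχ
      exact if_neg hχ
    · rw [Fintype.sum_sigma]
      have h1 : ∀ L : P, (∑ j, (if y ≤ L.1 then a⁻¹ * (bas L).repr (t L) j else 0) • u ⟨L, j⟩) =
          a⁻¹ • if y ≤ L.1 then transSum F L.1 f else 0 := by
        intro L
        split_ifs
        · have := congrArg Subtype.val ((bas L).sum_repr (t L))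
          simp only [Submodule.coe_sum, Submodule.coe_smul] at this
          simp only [mul_smul, ← Finset.smul_sum]
          rw [this]
        · simp
      rw [Finset.sum_congr rfl fun L _ => h1 L, ← Finset.smul_sum, sum_transSum_hyperplanes hH y hfy,
        smul_smul, inv_mul_cancel₀ ha, one_smul]

omit [Finite K] in
theorem isAdapted_of_isEmpty {L X : Type*} [AddCommGroup L] [Module K L] [Subsingleton H]
    [Fintype X] [IsEmpty X] (ι : X → L →ₗ[K] H) (u : X → H → F) : IsAdapted ι u := by
  refine ⟨isEmptyElim, isEmptyElim, isEmptyElim, linearIndependent_empty_type, ?_⟩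
  intro y f _ hs
  refine ⟨isEmptyElim, isEmptyElim, ?_⟩
  ext h
  have : Unique H := uniqueOfSubsingleton h
  simpa [Subsingleton.elim default h] using hs

-- The `u χ` form a basis of the kernel of the summation functional, which has codimension one in
-- the functions on `H`.
omit [Finite K] in
theorem IsAdapted.card_add_one {L X : Type*} [AddCommGroup L] [Module K L] [Fintype X]
    {ι : X → L →ₗ[K] H} {u : X → H → F} (h : IsAdapted ι u) :
    Fintype.card X + 1 = Fintype.card H := by
  let s : (H → F) →ₗ[F] F := ∑ x, LinearMap.proj x
  have hs : ∀ f, s f = ∑ x, f x := fun f => by simp [s]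
  have hspan : Submodule.span F (Set.range u) = LinearMap.ker s := by
    apply le_antisymm
    · rw [Submodule.span_le]
      rintro _ ⟨χ, rfl⟩
      exact (hs _).trans (h.sum_eq_zero χ)
    · intro f hf
      obtain ⟨c, -, rfl⟩ := h.exists_coeff ⊥ f (by simp) ((hs f).symm.trans hf)
      exact Submodule.sum_mem _ fun χ _ =>
        Submodule.smul_mem _ _ (Submodule.subset_span ⟨χ, rfl⟩)
  have hrange : LinearMap.range s = ⊤ := LinearMap.range_eq_top.2 fun c => by
    classical
    exact ⟨Pi.single 0 c, by rw [hs]; simp⟩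
  have h1 := s.finrank_range_add_finrank_ker
  rw [hrange, finrank_top, Module.finrank_self, ← hspan, finrank_span_eq_card h.linearIndependent,
    Module.finrank_fintype_fun_eq_card] at h1
  omega

end Family

/-! ### Splitting the complex of `H × K` into a cone and shifted copies -/

section Splitting

universe u

variable {K F : Type*} [Field K] [Finite K] [Field F]

attribute [local instance] fintypeSubmodule

section Decomposition

variable {H L X : Type*} [AddCommGroup H] [Module K H] [Fintype H] [AddCommGroup L] [Module K L]
  [Finite L] [Fintype X]

open Classical in
/-- The value at `up y h` of the function assembled from the components `b` and `g`. -/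
noncomputable def upVal (ι : X → L →ₗ[K] H) (u : X → H → F)
    (b : Submodule K H → F) (g : X → Submodule K L → F) (y : Submodule K H) (h : H) : F :=
  -- With this scaling `b y` is the sum over the distinct subspaces `up y h`, so it enters the cone
  -- differential with coefficient 1.
  (Nat.card H : F)⁻¹ * Nat.card y * b y +
    ∑ χ, if y ≤ LinearMap.range (ι χ) then g χ (y.comap (ι χ)) * u χ h else 0

open Classical in
/-- The function on subspaces of `H × K` assembled from functions on subspaces of `H` and of `L`. -/
noncomputable def assemble (ι : X → L →ₗ[K] H) (u : X → H → F) :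
    (((Submodule K H → F) × (Submodule K H → F)) × (X → Submodule K L → F)) →ₗ[F]
      (Submodule K (H × K) → F) where
  -- The chosen `h` is determined modulo `y`. For an adapted family the value does not depend on it,
  -- as every `u χ` that contributes is `y`-invariant.
  toFun p x := if hx : ∃ h : H, (h, (1 : K)) ∈ x then
      upVal ι u p.1.2 p.2 (x.comap (LinearMap.inl K H K)) hx.choose
    else p.1.1 (x.comap (LinearMap.inl K H K))
  map_add' p p' := by
    ext x
    by_cases hx : ∃ h : H, (h, (1 : K)) ∈ x
    · simp only [Pi.add_apply, dif_pos hx, upVal, Prod.snd_add, Prod.fst_add]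
      rw [add_add_add_comm, ← Finset.sum_add_distrib, mul_add]
      congr 1
      exact Finset.sum_congr rfl fun χ _ => by split_ifs <;> simp [add_mul]
    · simp [dif_neg hx]
  map_smul' c p := by
    ext x
    by_cases hx : ∃ h : H, (h, (1 : K)) ∈ x
    · simp only [Pi.smul_apply, dif_pos hx, upVal, Prod.smul_snd, Prod.smul_fst, smul_eq_mul,
        RingHom.id_apply, mul_add, Finset.mul_sum]
      congr 1
      · ring
      · exact Finset.sum_congr rfl fun χ _ => by split_ifs <;> simp [mul_assoc]
    · simp [dif_neg hx]

variable {ι : X → L →ₗ[K] H} {u : X → H → F}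

omit [Finite K] [Finite L] in
theorem assemble_lo (p : ((Submodule K H → F) × (Submodule K H → F)) × (X → Submodule K L → F))
    (y : Submodule K H) : assemble ι u p (lo y) = p.1.1 y := by
  have hx : ¬ ∃ h : H, (h, (1 : K)) ∈ lo y := by
    rintro ⟨h, hh⟩
    exact one_ne_zero (mem_lo.1 hh).2
  have hy : (lo y).comap (LinearMap.inl K H K) = y := by ext v; simp [mem_lo]
  simp only [assemble, LinearMap.coe_mk, AddHom.coe_mk, dif_neg hx, hy]

omit [Finite K] [Finite L] in
theorem assemble_up (hA : IsAdapted ι u)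
    (p : ((Submodule K H → F) × (Submodule K H → F)) × (X → Submodule K L → F))
    (y : Submodule K H) (h : H) : assemble ι u p (up y h) = upVal ι u p.1.2 p.2 y h := by
  have hx : ∃ h' : H, (h', (1 : K)) ∈ up y h := ⟨h, mem_up.2 (by simp)⟩
  have hy : (up y h).comap (LinearMap.inl K H K) = y := by ext v; simp [mem_up]
  have key : assemble ι u p (up y h) = upVal ι u p.1.2 p.2 y hx.choose := by
    simp only [assemble, LinearMap.coe_mk, AddHom.coe_mk, dif_pos hx, hy]
  rw [key, upVal, upVal]
  congr 1
  refine Finset.sum_congr rfl fun χ _ => ?_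
  split_ifs with hχ
  · have h1 : hx.choose - h ∈ y := by simpa using mem_up.1 hx.choose_spec
    obtain ⟨z, hz⟩ := hχ h1
    rw [show hx.choose = h + ι χ z by rw [hz]; abel, hA.apply_add]
  · rfl

omit [Finite K] [Finite L] in
theorem natCard_ne_zero (hK : (Nat.card K : F) ≠ 0) : (Nat.card H : F) ≠ 0 := by
  rw [Module.natCard_eq_pow_finrank (K := K), Nat.cast_pow]
  exact pow_ne_zero _ hK

omit [Finite K] [Finite L] in
theorem sum_upVal (hK : (Nat.card K : F) ≠ 0) (hA : IsAdapted ι u)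
    (b : Submodule K H → F) (g : X → Submodule K L → F) (y : Submodule K H) :
    ∑ h, upVal ι u b g y h = Nat.card y * b y := by
  classical
  simp only [upVal]
  rw [Finset.sum_add_distrib, Finset.sum_const, Finset.card_univ, ← Nat.card_eq_fintype_card,
    nsmul_eq_mul, mul_assoc, mul_inv_cancel_left₀ (natCard_ne_zero (K := K) hK), Finset.sum_comm,
    Finset.sum_eq_zero, add_zero]
  intro χ _
  split_ifs
  · rw [← Finset.mul_sum, hA.sum_eq_zero, mul_zero]
  · simp

omit [Finite K] [Finite L] in
theorem eq_zero_of_upVal_eq_zero (hK : (Nat.card K : F) ≠ 0) (hA : IsAdapted ι u)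
    {b : Submodule K H → F} {g : X → Submodule K L → F} {y : Submodule K H}
    (h0 : ∀ h, upVal ι u b g y h = 0) :
    b y = 0 ∧ ∀ χ, y ≤ LinearMap.range (ι χ) → g χ (y.comap (ι χ)) = 0 := by
  classical
  have hb : b y = 0 := by
    have := sum_upVal hK hA b g y
    rw [Finset.sum_eq_zero fun h _ => h0 h] at this
    exact (mul_eq_zero.1 this.symm).resolve_left (natCard_submodule_ne_zero hK y)
  refine ⟨hb, fun χ hχ => ?_⟩
  have := Fintype.linearIndependent_iff.1 hA.linearIndependent
    (fun χ => if y ≤ LinearMap.range (ι χ) then g χ (y.comap (ι χ)) else 0) ?_ χ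
  · simpa [hχ] using this
  · ext h
    have := h0 h
    simp only [upVal, hb, mul_zero, zero_add] at this
    rw [Finset.sum_apply]
    refine Eq.trans ?_ this
    exact Finset.sum_congr rfl fun χ _ => by split_ifs <;> simp

omit [Finite K] [Finite L] in
theorem comap_map_of_isAdapted (hA : IsAdapted ι u) (χ : X) (z : Submodule K L) :
    (z.map (ι χ)).comap (ι χ) = z :=
  Submodule.comap_map_eq_of_injective (hA.injective χ) z

omit [Finite K] [Finite L] in
theorem assemble_injective (hK : (Nat.card K : F) ≠ 0) (hA : IsAdapted ι u) :
    Function.Injective (assemble ι u) := by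
  rw [← LinearMap.ker_eq_bot, LinearMap.ker_eq_bot']
  intro p hp
  have h0 := fun y => eq_zero_of_upVal_eq_zero hK hA (y := y) (b := p.1.2) (g := p.2) fun h => by
    rw [← assemble_up hA, hp]; rfl
  refine Prod.ext (Prod.ext (funext fun y => ?_) (funext fun y => (h0 y).1))
    (funext fun χ => funext fun z => ?_)
  · rw [← assemble_lo p, hp]; rfl
  · have := (h0 (z.map (ι χ))).2 χ LinearMap.map_le_range
    rwa [comap_map_of_isAdapted hA] at this

omit [Finite K] [Finite L] in
theorem assemble_surjective (hK : (Nat.card K : F) ≠ 0) (hA : IsAdapted ι u) :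
    Function.Surjective (assemble ι u) := by
  classical
  intro f
  have hH := natCard_ne_zero (H := H) (K := K) hK
  have hex : ∀ y : Submodule K H, ∃ c : X → F, (∀ χ, ¬ y ≤ LinearMap.range (ι χ) → c χ = 0) ∧
      (fun h => f (up y h) - (Nat.card H : F)⁻¹ * ∑ h, f (up y h)) = ∑ χ, c χ • u χ := by
    intro y
    refine hA.exists_coeff y _ (fun z hz h => ?_) ?_
    · have : up y (h + z) = up y h := up_eq_up.2 ⟨rfl, by simpa using hz⟩
      simp only [this]
    · rw [Finset.sum_sub_distrib, Finset.sum_const, Finset.card_univ, ← Nat.card_eq_fintype_card,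
        nsmul_eq_mul, mul_inv_cancel_left₀ hH, sub_self]
  choose c hc hf using hex
  refine ⟨((fun y => f (lo y), fun y => (Nat.card y : F)⁻¹ * ∑ h, f (up y h)),
    fun χ z => c (z.map (ι χ)) χ), funext fun x => ?_⟩
  obtain ⟨y, rfl⟩ | ⟨y, h, rfl⟩ := eq_lo_or_eq_up x
  · rw [assemble_lo]
  · rw [assemble_up hA, upVal, mul_assoc,
      mul_inv_cancel_left₀ (natCard_submodule_ne_zero hK y), ← eq_sub_iff_add_eq']
    have := congrFun (hf y) h
    rw [Finset.sum_apply] at this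
    rw [this]
    refine Finset.sum_congr rfl fun χ _ => ?_
    split_ifs with hχ
    · change c ((y.comap (ι χ)).map (ι χ)) χ * u χ h = _
      rw [Submodule.map_comap_eq_self hχ]; rfl
    · rw [hc y χ hχ]; simp

-- Subspaces of `L` correspond to subspaces of `H` inside the range of `φ`, so discarding the covers
-- outside the range leaves the incidence map of `L`.
omit [Fintype X] in
theorem sum_covers_range {φ : L →ₗ[K] H} (hφ : Function.Injective φ) (G : Submodule K L → F)
    {y : Submodule K H} (hy : y ≤ LinearMap.range φ)
    [DecidablePred fun y' : Submodule K H => y' ≤ LinearMap.range φ]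
    [DecidablePred fun y' : Submodule K H => y ≤ y' ∧ finrank K y + 1 = finrank K y'] :
    latticeBd K F L G (y.comap φ) =
      ∑ y' : Submodule K H, if y ≤ y' ∧ finrank K y + 1 = finrank K y' then
        (if y' ≤ LinearMap.range φ then G (y'.comap φ) else 0) else 0 := by
  classical
  rw [latticeBd_apply]
  have hfr : ∀ z : Submodule K L, finrank K (z.map φ) = finrank K z := fun z =>
    (Submodule.equivMapOfInjective φ hφ z).finrank_eq.symm
  have hy' : (y.comap φ).map φ = y := Submodule.map_comap_eq_self hy
  refine Fintype.sum_of_injective (Submodule.map φ) (Submodule.map_injective_of_injective hφ) _ _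
    (fun y' hy' => ?_) fun z => ?_
  · have : ¬ y' ≤ LinearMap.range φ := fun h => hy' ⟨_, Submodule.map_comap_eq_self h⟩
    simp [this]
  · have h1 : y ≤ z.map φ ↔ y.comap φ ≤ z := by
      rw [← Submodule.map_le_map_iff_of_injective hφ, hy']
    have h2 : finrank K (y.comap φ) = finrank K y := by rw [← hfr, hy']
    rw [if_pos LinearMap.map_le_range, Submodule.comap_map_eq_of_injective hφ]
    simp only [h1, h2, hfr]

theorem assemble_comm (hK : (Nat.card K : F) ≠ 0) (hA : IsAdapted ι u)
    (p : ((Submodule K H → F) × (Submodule K H → F)) × (X → Submodule K L → F)) :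
    assemble ι u (LinearMap.prodMap (cone (Nat.card K : F) (latticeBd K F H))
      (LinearMap.compLeft (latticeBd K F L) X) p) =
      latticeBd K F (H × K) (assemble ι u p) := by
  classical
  obtain ⟨⟨a, b⟩, g⟩ := p
  ext x
  obtain ⟨y, rfl⟩ | ⟨y, h, rfl⟩ := eq_lo_or_eq_up x
  · rw [assemble_lo, latticeBd_lo hK]
    simp only [assemble_lo, assemble_up hA, sum_upVal hK hA]
    rw [inv_mul_cancel_left₀ (natCard_submodule_ne_zero hK y)]
    rfl
  · rw [assemble_up hA, latticeBd_up hK, latticeBd_apply]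
    simp only [assemble_up hA, LinearMap.prodMap_apply, cone_apply]
    have hsplit : ∀ y' : Submodule K H,
        (if y ≤ y' ∧ finrank K y + 1 = finrank K y' then upVal ι u b g y' h else 0) =
        (Nat.card H : F)⁻¹ * Nat.card y * (Nat.card K *
          (if y ≤ y' ∧ finrank K y + 1 = finrank K y' then b y' else 0)) +
        ∑ χ, (if y ≤ y' ∧ finrank K y + 1 = finrank K y' then
          (if y' ≤ LinearMap.range (ι χ) then g χ (y'.comap (ι χ)) else 0) else 0) * u χ h := by
      intro y'
      split_ifs with hy'
      -- Passing to a cover multiplies the scaling factor `|y|` by `q`; this is the source of the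
      -- `q` in the cone.
      · have hcard : Nat.card y' = Nat.card y * Nat.card K := by
          rw [Module.natCard_eq_pow_finrank (K := K) (V := y'), ← hy'.2, pow_succ,
            ← Module.natCard_eq_pow_finrank]
        rw [upVal, hcard, Nat.cast_mul]
        congr 1
        · ring
        · exact Finset.sum_congr rfl fun χ _ => by split_ifs <;> simp
      · simp
    rw [Finset.sum_congr rfl fun y' _ => hsplit y', Finset.sum_add_distrib, ← Finset.mul_sum,
      ← Finset.mul_sum, Finset.sum_comm, ← latticeBd_apply, upVal]
    congr 1
    refine Finset.sum_congr rfl fun χ _ => ?_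
    rw [← Finset.sum_mul]
    split_ifs with hy
    · rw [← sum_covers_range (hA.injective χ) (g χ) hy]
      rfl
    -- If `y` is not inside the hyperplane, neither is any cover of it.
    · rw [Finset.sum_eq_zero, zero_mul]
      intro y' _
      split_ifs with h1 h2
      · exact absurd (h1.1.trans h2) hy
      · rfl
      · rfl

omit [Finite K] [Finite L] in
theorem assemble_mem_latticeGr (hK : (Nat.card K : F) ≠ 0) (hA : IsAdapted ι u) (k : ℤ)
    (p : ((Submodule K H → F) × (Submodule K H → F)) × (X → Submodule K L → F)) :
    assemble ι u p ∈ latticeGr K F (H × K) k ↔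
      p ∈ (coneGr (latticeGr K F H) k).prod
        (Submodule.pi (Set.univ : Set X) fun _ => latticeGr K F L (k - 1)) := by
  have hfr : ∀ χ (z : Submodule K L), finrank K (z.map (ι χ)) = finrank K z := fun χ z =>
    (Submodule.equivMapOfInjective (ι χ) (hA.injective χ) z).finrank_eq.symm
  constructor
  · intro hp
    have h0 : ∀ y : Submodule K H, (finrank K y : ℤ) ≠ k - 1 → _ := fun y hy =>
      eq_zero_of_upVal_eq_zero hK hA (y := y) (b := p.1.2) (g := p.2) fun h => by
        rw [← assemble_up hA]
        exact hp _ (by rw [finrank_up]; push_cast; omega)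
    refine ⟨⟨fun y hy => ?_, fun y hy => (h0 y hy).1⟩, fun χ _ z hz => ?_⟩
    · rw [← assemble_lo p]
      exact hp _ (by rwa [finrank_lo])
    · have := (h0 (z.map (ι χ)) (by rwa [hfr])).2 χ LinearMap.map_le_range
      rwa [comap_map_of_isAdapted hA] at this
  · rintro ⟨⟨ha, hb⟩, hg⟩ x hx
    obtain ⟨y, rfl⟩ | ⟨y, h, rfl⟩ := eq_lo_or_eq_up x
    · rw [assemble_lo]
      exact ha y (by rwa [finrank_lo] at hx)
    · have hy : (finrank K y : ℤ) ≠ k - 1 := by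
        rw [finrank_up] at hx; push_cast at hx; omega
      rw [assemble_up hA, upVal, hb y hy, mul_zero, zero_add]
      refine Finset.sum_eq_zero fun χ _ => ?_
      split_ifs with hχ
      · rw [hg χ trivial (y.comap (ι χ)), zero_mul]
        rwa [← hfr χ, Submodule.map_comap_eq_self hχ]
      · rfl

end Decomposition

section Transport

variable {V W : Type*} [AddCommGroup V] [Module K V] [Finite V] [AddCommGroup W] [Module K W]
  [Finite W] (e : V ≃ₗ[K] W)

/-- The isomorphism of function spaces induced by a linear isomorphism. -/
def latticeEquiv (F : Type*) [Field F] : (Submodule K V → F) ≃ₗ[F] (Submodule K W → F) :=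
  LinearEquiv.funCongrLeft F F (Submodule.orderIsoMapComap e).symm.toEquiv

omit [Finite K] [Finite V] [Finite W] in
theorem latticeEquiv_apply_map (f : Submodule K V → F) (y : Submodule K V) :
    latticeEquiv e F f (Submodule.orderIsoMapComap e y) = f y :=
  congrArg f ((Submodule.orderIsoMapComap e).symm_apply_apply y)

omit [Finite K] [Finite V] [Finite W] in
theorem finrank_orderIsoMapComap (y : Submodule K V) :
    finrank K (Submodule.orderIsoMapComap e y) = finrank K y :=
  LinearEquiv.finrank_map_eq e y

theorem latticeEquiv_comm (f : Submodule K V → F) :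
    latticeEquiv e F (latticeBd K F V f) = latticeBd K F W (latticeEquiv e F f) := by
  classical
  ext y
  obtain ⟨y, rfl⟩ := (Submodule.orderIsoMapComap e).surjective y
  rw [latticeEquiv_apply_map, latticeBd_apply, latticeBd_apply]
  refine Fintype.sum_equiv (Submodule.orderIsoMapComap e).toEquiv _ _ fun x => ?_
  change _ = if _ ≤ Submodule.orderIsoMapComap e x ∧
    _ = finrank K (Submodule.orderIsoMapComap e x) then
      latticeEquiv e F f (Submodule.orderIsoMapComap e x) else 0
  rw [latticeEquiv_apply_map]
  simp only [OrderIso.le_iff_le, finrank_orderIsoMapComap]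

omit [Finite K] [Finite V] [Finite W] in
theorem latticeEquiv_mem (k : ℤ) (f : Submodule K V → F) :
    latticeEquiv e F f ∈ latticeGr K F W k ↔ f ∈ latticeGr K F V k := by
  constructor
  · intro h x hx
    rw [← latticeEquiv_apply_map e f]
    exact h _ (by rwa [finrank_orderIsoMapComap])
  · intro h x hx
    obtain ⟨x, rfl⟩ := (Submodule.orderIsoMapComap e).surjective x
    rw [latticeEquiv_apply_map]
    exact h _ (by rwa [finrank_orderIsoMapComap] at hx)

end Transport

theorem exists_isAdapted_fin {K : Type u} [Field K] [Fintype K] (hK : (Nat.card K : F) ≠ 0) (n : ℕ) :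
    ∃ (X : Type u) (_ : Fintype X) (ι : X → (Fin (n - 1) → K) →ₗ[K] (Fin n → K))
      (u : X → (Fin n → K) → F), IsAdapted ι u ∧ Fintype.card X = Nat.card K ^ n - 1 := by
  have key : ∃ (X : Type u) (_ : Fintype X) (ι : X → (Fin (n - 1) → K) →ₗ[K] (Fin n → K))
      (u : X → (Fin n → K) → F), IsAdapted ι u := by
    classical
    cases n with
    | zero =>
      -- For `n = 0` there are `q^0 - 1 = 0` summands, so the truncated dimension `n - 1` plays no
      -- role.
      exact ⟨PEmpty, inferInstance, fun χ => χ.elim, fun χ => χ.elim, isAdapted_of_isEmpty _ _⟩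
    | succ n => exact exists_isAdapted hK (Module.finrank_fin_fun K)
  obtain ⟨X, hX, ι, u, hA⟩ := key
  refine ⟨X, hX, ι, u, hA, ?_⟩
  have := hA.card_add_one
  rw [Fintype.card_fun, Fintype.card_fin, ← Nat.card_eq_fintype_card (α := K)] at this
  omega

/-- The complex of `K ^ (n + 1)` in terms of those of `K ^ n` and `K ^ (n - 1)`. -/
theorem latticeBd_recursion (hK : (Nat.card K : F) ≠ 0) (n m : ℕ)
    (hH : IsComplex m (cone (Nat.card K : F) (latticeBd K F (Fin n → K)))
      (coneGr (latticeGr K F (Fin n → K))))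
    (hL : IsComplex m (latticeBd K F (Fin (n - 1) → K)) (latticeGr K F (Fin (n - 1) → K))) :
    IsComplex m (latticeBd K F (Fin (n + 1) → K)) (latticeGr K F (Fin (n + 1) → K)) ∧
    ∀ (k : ℤ) (i : ℕ), i ≤ m →
      hdim (latticeBd K F (Fin (n + 1) → K)) (latticeGr K F (Fin (n + 1) → K)) m k i =
        hdim (cone (Nat.card K : F) (latticeBd K F (Fin n → K)))
          (coneGr (latticeGr K F (Fin n → K))) m k i +
        (Nat.card K ^ n - 1) * hdim (latticeBd K F (Fin (n - 1) → K))
          (latticeGr K F (Fin (n - 1) → K)) m (k - 1) i := by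
  classical
  have := Fintype.ofFinite K
  obtain ⟨X, _, ι, u, hA, hX⟩ := exists_isAdapted_fin (F := F) hK n
  let e₁ := LinearEquiv.ofBijective (assemble ι u)
    ⟨assemble_injective hK hA, assemble_surjective hK hA⟩
  let e₂ : ((Fin n → K) × K) ≃ₗ[K] (Fin (n + 1) → K) :=
    LinearEquiv.ofFinrankEq _ _ (by simp)
  let e := e₁.trans (latticeEquiv e₂ F)
  have hcomm : ∀ p, e (LinearMap.prodMap (cone (Nat.card K : F) (latticeBd K F (Fin n → K)))
      (LinearMap.compLeft (latticeBd K F (Fin (n - 1) → K)) X) p) =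
      latticeBd K F (Fin (n + 1) → K) (e p) := fun p =>
    (congrArg (latticeEquiv e₂ F) (assemble_comm hK hA p)).trans (latticeEquiv_comm e₂ _)
  have hmem : ∀ k p, e p ∈ latticeGr K F (Fin (n + 1) → K) k ↔
      p ∈ (coneGr (latticeGr K F (Fin n → K)) k).prod
        (Submodule.pi (Set.univ : Set X) fun _ => latticeGr K F (Fin (n - 1) → K) (k - 1)) :=
    fun k p => (latticeEquiv_mem e₂ k _).trans (assemble_mem_latticeGr hK hA k p)
  have hC := hH.prod (hL.shift.pi X)
  refine ⟨hC.equiv e hcomm hmem, fun k i hi => ?_⟩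
  rw [← hdim_equiv e hcomm hmem hC k hi, hdim_prod hH (hL.shift.pi X) k hi,
    hdim_pi hL.shift X k hi, hdim_shift, hX]

end Splitting

/-! ### Betti numbers for `m = 2` and `m = 3`, and the main theorem -/

section Betti

variable {K F : Type*} [Field K] [Finite K] [Field F]

theorem betti_eq_hdim (n m : ℕ) (k : ℤ) (i : ℕ) :
    betti K F n m k i =
      hdim (latticeBd K F (Fin n → K)) (latticeGr K F (Fin n → K)) m k i := by
  rw [← bd_eq_latticeBd]; rfl

theorem nontrivial_homology_iff (n m : ℕ) (k : ℤ) (i : ℕ) :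
    Nontrivial (Homology K F n m k i) ↔ betti K F n m k i ≠ 0 := by
  rw [← Nat.pos_iff_ne_zero, betti, Module.finrank_pos_iff]

theorem seqExact_iff {n m : ℕ}
    (hC : IsComplex m (latticeBd K F (Fin n → K)) (latticeGr K F (Fin n → K))) (k : ℤ) {i : ℕ}
    (hi : i ≤ m) :
    SeqExact K F n m k i ↔
      ∀ t : ℤ, betti K F n m (k + t * m) i = 0 ∧ betti K F n m (k - i + t * m) (m - i) = 0 := by
  refine forall_congr' fun t => ?_
  rw [betti_eq_hdim, betti_eq_hdim, hdim_eq_zero_iff, hdim_eq_zero_iff]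
  have h1 := bdr_le_cyc hC (k := k + t * m) hi
  have h2 := bdr_le_cyc hC (k := k - i + t * m) (Nat.sub_le m i)
  rw [bd_eq_latticeBd]
  refine and_congr ⟨fun h => h.le, fun h => le_antisymm h h1⟩ ?_
  have hb : bdr (latticeBd K F (Fin n → K)) (latticeGr K F (Fin n → K)) m (k - i + t * m) (m - i) =
      (chains K F n (k + t * m)).map (latticeBd K F (Fin n → K) ^ i) := by
    rw [bdr, Nat.sub_sub_self hi,
      show k - (i : ℤ) + t * m + m - ((m - i : ℕ) : ℤ) = k + t * m by push_cast [hi]; ring]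
    rfl
  rw [hb] at h2 ⊢
  exact ⟨fun h => h.le, fun h => le_antisymm h h2⟩

section Zero

variable {V : Type*} [AddCommGroup V] [Module K V] [Finite V] [Subsingleton V]

theorem latticeBd_eq_zero : latticeBd K F V = 0 := by
  classical
  refine LinearMap.ext fun f => funext fun y => ?_
  rw [latticeBd_apply]
  exact Finset.sum_eq_zero fun x _ => if_neg fun h => by
    rw [Subsingleton.elim x y] at h
    omega

theorem isComplex_of_subsingleton {m : ℕ} (hm : m ≠ 0) :
    IsComplex m (latticeBd K F V) (latticeGr K F V) := by
  rw [latticeBd_eq_zero]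
  exact ⟨zero_pow hm, fun k x _ => Submodule.zero_mem _⟩

theorem hdim_of_subsingleton {m i : ℕ} (h0 : i ≠ 0) (hi : i < m) (k : ℤ) :
    hdim (latticeBd K F V) (latticeGr K F V) m k i = if k = 0 then 1 else 0 := by
  have hadd := hdim_add_finrank_bdr
    (isComplex_of_subsingleton (K := K) (F := F) (V := V) (m := m) (by omega)) k hi.le
  have hc : cyc (latticeBd K F V) (latticeGr K F V) k i = latticeGr K F V k := by
    rw [cyc, latticeBd_eq_zero, zero_pow h0, LinearMap.ker_zero, top_inf_eq]
  have hb : bdr (latticeBd K F V) (latticeGr K F V) m k i = ⊥ := by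
    rw [bdr, latticeBd_eq_zero, zero_pow (by omega), Submodule.map_zero]
  rw [hc, hb, finrank_bot, add_zero] at hadd
  rw [hadd]
  have hfr : ∀ x : Submodule K V, finrank K x = 0 := fun x => finrank_zero_of_subsingleton
  split_ifs with hk
  · have : latticeGr K F V k = ⊤ := by
      rw [eq_top_iff]
      intro f _ x hx
      exact absurd (by rw [hfr, hk]; rfl) hx
    have _ : Fintype (Submodule K V) := Fintype.ofFinite _
    rw [this, finrank_top, Module.finrank_fintype_fun_eq_card, Fintype.card_eq_one_iff]
    exact ⟨⊥, fun _ => Subsingleton.elim _ _⟩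
  · have : latticeGr K F V k = ⊥ := by
      rw [eq_bot_iff]
      intro f hf
      rw [Submodule.mem_bot]
      ext x
      exact hf x (by rw [hfr]; exact Ne.symm hk)
    rw [this, finrank_bot]

end Zero

theorem isComplex_lattice {m : ℕ} (hm : m ≠ 0) (hK : (Nat.card K : F) ≠ 0)
    (hcone : ∀ n, IsComplex m (latticeBd K F (Fin n → K)) (latticeGr K F (Fin n → K)) →
      IsComplex m (cone (Nat.card K : F) (latticeBd K F (Fin n → K)))
        (coneGr (latticeGr K F (Fin n → K)))) (n : ℕ) :
    IsComplex m (latticeBd K F (Fin n → K)) (latticeGr K F (Fin n → K)) := by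
  induction n using Nat.strong_induction_on with
  | _ n ih =>
    cases n with
    | zero => exact isComplex_of_subsingleton hm
    | succ n =>
      exact (latticeBd_recursion hK n m (hcone n (ih n (by omega))) (ih (n - 1) (by omega))).1

section Two

variable (hK : (Nat.card K : F) ≠ 0) (hq : 1 + (Nat.card K : F) = 0)

include hK hq

theorem isComplex_two (n : ℕ) :
    IsComplex 2 (latticeBd K F (Fin n → K)) (latticeGr K F (Fin n → K)) :=
  isComplex_lattice two_ne_zero hK (fun _ h => isComplex_cone_two hq h) n

theorem betti_two_succ (n : ℕ) (k : ℤ) :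
    betti K F (n + 1) 2 k 1 = (Nat.card K ^ n - 1) * betti K F (n - 1) 2 (k - 1) 1 := by
  rw [betti_eq_hdim, betti_eq_hdim, (latticeBd_recursion hK n 2
    (isComplex_cone_two hq (isComplex_two hK hq n)) (isComplex_two hK hq _)).2 k 1 (by norm_num),
    hdim_cone_two hq, zero_add]

theorem betti_two_odd (j : ℕ) (k : ℤ) : betti K F (2 * j + 1) 2 k 1 = 0 := by
  induction j generalizing k with
  -- The multiplicity `q^0 - 1` is zero, and this factor propagates to all odd dimensions.
  | zero => rw [betti_two_succ hK hq]; simp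
  | succ j ih =>
    rw [betti_two_succ hK hq, show 2 * (j + 1) - 1 = 2 * j + 1 by omega, ih, mul_zero]

theorem betti_two_even (j : ℕ) :
    betti K F (2 * j) 2 j 1 = ∏ i ∈ Finset.range j, (Nat.card K ^ (2 * i + 1) - 1) := by
  induction j with
  | zero => rw [betti_eq_hdim, mul_zero, hdim_of_subsingleton one_ne_zero one_lt_two]; rfl
  | succ j ih =>
    rw [show 2 * (j + 1) = 2 * j + 1 + 1 by ring, betti_two_succ hK hq, Nat.add_sub_cancel,
      show ((j + 1 : ℕ) : ℤ) - 1 = j by push_cast; ring, ih, Finset.prod_range_succ, mul_comm]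

end Two

/-- The sequence `β^n` of Betti numbers for `m = 3`. -/
def betaSeq (q : ℕ) : ℕ → ℕ
  | 0 => 1
  | 1 => 1
  | n + 2 => betaSeq q (n + 1) + betaSeq q n * (q ^ (n + 1) - 1)

theorem betaSeq_pos (q n : ℕ) : 0 < betaSeq q n := by
  induction n using Nat.strong_induction_on with
  | _ n ih =>
    match n, ih with
    | 0, _ => exact one_pos
    | 1, _ => exact one_pos
    | n + 2, ih => exact Nat.add_pos_left (ih (n + 1) (by omega)) _

section Three

variable (hK : (Nat.card K : F) ≠ 0) (hq : 1 + (Nat.card K : F) + (Nat.card K : F) ^ 2 = 0)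

include hK hq

theorem isComplex_three (n : ℕ) :
    IsComplex 3 (latticeBd K F (Fin n → K)) (latticeGr K F (Fin n → K)) :=
  isComplex_lattice three_ne_zero hK (fun _ h => isComplex_cone_three hq h) n

theorem betti_three_one_succ (n : ℕ) (k : ℤ) :
    betti K F (n + 1) 3 k 1 =
      betti K F n 3 k 2 + (Nat.card K ^ n - 1) * betti K F (n - 1) 3 (k - 1) 1 := by
  rw [betti_eq_hdim, betti_eq_hdim, betti_eq_hdim, (latticeBd_recursion hK n 3
    (isComplex_cone_three hq (isComplex_three hK hq n)) (isComplex_three hK hq _)).2 k 1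
      (by norm_num), hdim_cone_three_one hq (isComplex_three hK hq n)]

theorem betti_three_two_succ (n : ℕ) (k : ℤ) :
    betti K F (n + 1) 3 k 2 =
      betti K F n 3 (k - 1) 1 + (Nat.card K ^ n - 1) * betti K F (n - 1) 3 (k - 1) 2 := by
  rw [betti_eq_hdim, betti_eq_hdim, betti_eq_hdim, (latticeBd_recursion hK n 3
    (isComplex_cone_three hq (isComplex_three hK hq n)) (isComplex_three hK hq _)).2 k 2
      (by norm_num), hdim_cone_three_two hq (isComplex_three hK hq n)]

/-- The cone exchanges the two types of index and the copies shift the degree by one, so both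
summands contribute at the same place: `n / 2` for `i = 1` and `(n + 1) / 2` for `i = 2`. -/
theorem betti_three (n : ℕ) : ∀ k : ℤ,
    betti K F n 3 k 1 = (if k = (n / 2 : ℕ) then betaSeq (Nat.card K) n else 0) ∧
    betti K F n 3 k 2 = if k = ((n + 1) / 2 : ℕ) then betaSeq (Nat.card K) n else 0 := by
  induction n using Nat.strong_induction_on with
  | _ n ih =>
    match n, ih with
    | 0, _ =>
      intro k
      rw [betti_eq_hdim, betti_eq_hdim, hdim_of_subsingleton one_ne_zero (by norm_num),
        hdim_of_subsingleton two_ne_zero (by norm_num)]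
      exact ⟨rfl, rfl⟩
    | 1, ih =>
      intro k
      rw [betti_three_one_succ hK hq, betti_three_two_succ hK hq, (ih 0 one_pos _).1,
        (ih 0 one_pos _).2]
      simp [betaSeq, sub_eq_zero]
    | n + 2, ih =>
      intro k
      rw [betti_three_one_succ hK hq (n + 1), betti_three_two_succ hK hq (n + 1),
        Nat.add_sub_cancel,
        (ih (n + 1) (by omega) _).1, (ih (n + 1) (by omega) _).2, (ih n (by omega) _).1,
        (ih n (by omega) _).2]
      have e1 : k - 1 = (n / 2 : ℕ) ↔ k = ((n + 2) / 2 : ℕ) := by omega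
      have e2 : k - 1 = ((n + 1) / 2 : ℕ) ↔ k = ((n + 2 + 1) / 2 : ℕ) := by omega
      simp only [e1, e2, betaSeq, show n + 1 + 1 = n + 2 from rfl]
      constructor <;> split_ifs <;> ring

end Three

theorem geom_sum_quantumChar {p q m : ℕ} [CharP F p] (h : quantumChar p q = m) (hm : m ≠ 0) :
    ∑ j ∈ Finset.range m, (q : F) ^ j = 0 := by
  have hmem : quantumChar p q ∈
      {i : ℕ | 1 < i ∧ ((∑ j ∈ Finset.range i, q ^ j : ℕ) : ZMod p) = 0} := by
    -- The infimum of the empty set is 0, so a nonzero value is attained.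
    refine Nat.sInf_mem (Set.nonempty_iff_ne_empty.2 fun he => hm ?_)
    rw [← h, quantumChar, he, Nat.sInf_empty]
  rw [h] at hmem
  have := (CharP.cast_eq_zero_iff F p _).2 ((ZMod.natCast_eq_zero_iff _ _).1 hmem.2)
  exact_mod_cast this

theorem isMiddleIndex_three_iff (n : ℕ) (l : ℤ) (i : ℕ) :
    IsMiddleIndex n 3 l i ↔ (l = (n / 2 : ℕ) ∧ i = 1) ∨ (l = ((n + 1) / 2 : ℕ) ∧ i = 2) := by
  unfold IsMiddleIndex
  omega

end Betti

end ProjIncidence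

theorem mainTheorem7 {K F : Type*} [Field K] [Finite K] [Field F] (p q : ℕ)
    (hq : Nat.card K = q) (hp : p.Prime) [CharP F p] (hpq : ¬ p ∣ q) :
    (quantumChar p q = 2 →
      (∀ n : ℕ, Odd n → ∀ k : ℤ, ProjIncidence.SeqExact K F n 2 k 1) ∧
      (∀ n k : ℕ, n = 2 * k →
        (ProjIncidence.betti K F n 2 k 1 : ℤ) =
          ∏ j ∈ Finset.range k, ((q : ℤ) ^ (2 * j + 1) - 1))) ∧
    (quantumChar p q = 3 →
      ∃ β : ℕ → ℤ,
        (β 0 = 1 ∧ β 1 = 1 ∧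
          ∀ n : ℕ, β (n + 2) = β (n + 1) + β n * ((q : ℤ) ^ (n + 1) - 1)) ∧
        ∀ n : ℕ, ∃ k k' : ℤ,
          (∀ (l : ℤ) (i : ℕ), ProjIncidence.IsMiddleIndex n 3 l i ↔
            (l = k ∧ i = 1) ∨ (l = k' ∧ i = 2)) ∧
          (∀ (l : ℤ) (i : ℕ), 0 < i → i < 3 →
            (Nontrivial (ProjIncidence.Homology K F n 3 l i) ↔
              (l = k ∧ i = 1) ∨ (l = k' ∧ i = 2))) ∧
          (∀ (l : ℤ) (i : ℕ), 0 < i → i < 3 →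
            (¬ ProjIncidence.SeqExact K F n 3 l i ↔
              ProjIncidence.SameSeq 3 l i k 1 ∨ ProjIncidence.SameSeq 3 l i k' 2)) ∧
          (ProjIncidence.betti K F n 3 k 1 : ℤ) = β n ∧
          (ProjIncidence.betti K F n 3 k' 2 : ℤ) = β n) := by
  subst hq
  have hK : (Nat.card K : F) ≠ 0 := fun h => hpq ((CharP.cast_eq_zero_iff F p _).1 h)
  have hpow : ∀ j, ((Nat.card K ^ j - 1 : ℕ) : ℤ) = (Nat.card K : ℤ) ^ j - 1 := fun j => by
    rw [Nat.cast_sub (Nat.one_le_pow _ _ Nat.card_pos)]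
    push_cast
    rfl
  refine ⟨fun h2 => ?_, fun h3 => ?_⟩
  · have hq : 1 + (Nat.card K : F) = 0 := by
      simpa [Finset.sum_range_succ] using ProjIncidence.geom_sum_quantumChar (F := F) h2 two_ne_zero
    refine ⟨?_, ?_⟩
    · rintro n ⟨j, rfl⟩ k
      rw [ProjIncidence.seqExact_iff (ProjIncidence.isComplex_two hK hq _) k one_le_two]
      exact fun t => ⟨ProjIncidence.betti_two_odd hK hq j _, ProjIncidence.betti_two_odd hK hq j _⟩
    · rintro n k rfl
      rw [ProjIncidence.betti_two_even hK hq, Nat.cast_prod]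
      exact Finset.prod_congr rfl fun j _ => hpow _
  · have hq : 1 + (Nat.card K : F) + (Nat.card K : F) ^ 2 = 0 := by
      simpa [Finset.sum_range_succ] using
        ProjIncidence.geom_sum_quantumChar (F := F) h3 three_ne_zero
    refine ⟨fun n => ProjIncidence.betaSeq (Nat.card K) n, ⟨rfl, rfl, fun n => ?_⟩, fun n =>
      ⟨(n / 2 : ℕ), ((n + 1) / 2 : ℕ), ProjIncidence.isMiddleIndex_three_iff n, ?_, ?_, ?_, ?_⟩⟩
    · rw [← hpow]
      simp only [ProjIncidence.betaSeq]
      push_cast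
      rfl
    all_goals have hb := ProjIncidence.betti_three hK hq n
    all_goals have hpos := (ProjIncidence.betaSeq_pos (Nat.card K) n).ne'
    · intro l i h0 hi
      rw [ProjIncidence.nontrivial_homology_iff]
      obtain rfl | rfl : i = 1 ∨ i = 2 := by omega
      · simp [(hb l).1, hpos]
      · simp [(hb l).2, hpos]
    · intro l i h0 hi
      rw [ProjIncidence.seqExact_iff (ProjIncidence.isComplex_three hK hq n) l hi.le, not_forall,
        ProjIncidence.SameSeq, ProjIncidence.SameSeq, ← exists_or]
      -- The equivalence holds for each `t` separately: one of the two homologies at `t` has type 1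
      -- and meets only `k`, the other has type 2 and meets only `k'`.
      refine exists_congr fun t => ?_
      obtain rfl | rfl : i = 1 ∨ i = 2 := by omega
      · simp only [(hb _).1, (hb _).2, Nat.reduceSub, ite_eq_right_iff, hpos, imp_false]
        generalize n / 2 = a, (n + 1) / 2 = b
        push_cast
        simp only [and_true, not_and_or, not_not, eq_comm (b := (l + t * 3 : ℤ)),
          eq_comm (b := (l - _ + t * 3 : ℤ))]
        tauto
      · simp only [(hb _).1, (hb _).2, Nat.reduceSub, ite_eq_right_iff, hpos, imp_false]
        generalize n / 2 = a, (n + 1) / 2 = b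
        push_cast
        simp only [and_true, not_and_or, not_not, eq_comm (b := (l + t * 3 : ℤ)),
          eq_comm (b := (l - _ + t * 3 : ℤ))]
        tauto
    · simp [(hb _).1]
    · simp [(hb _).2]
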